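/- Consider a bandit with $K\ge 1$ arms and horizon $T\ge 2$. An environment is a family of probability distributions $(f_t^k)_{1\le t\le T,\,1\le k\le K}$ on $\mathbb{R}$; the rewards $X_t^k\sim f_t^k$ are independent, with means $\mu_t^k$. For $a\in\mathbb{R}$, $b>0$ and a variation budget $V_T>0$, let $\mathcal{E}(V_T,T,K)$ be the class of environments such that every $f_t^k$ is $1/2$ sub-Gaussian, i.e. $\mathbb{E}[e^{\lambda(X_t^k-\mu_t^k)}]\le e^{\lambda^2/8}$ for all $\lambda\in\mathbb{R}$, every $\mu_t^k$ lies in $[a,a+b]$, and $\sum_{t=1}^{T-1}\max_k|\mu_{t+1}^k-\mu_t^k|\le V_T$. The regret of a policy selecting the arms $\varphi_1,\dots,\varphi_T$ is $R_T=\sum_{t=1}^T\max_k\mu_t^k-\mathbb{E}\big[\sum_{t=1}^T X_t^{\varphi_t}\big]$. Let $\tau=\lceil K^{1/3}(T/V_T)^{2/3}\rceil$ and $\gamma=1-K^{-1/3}(T/V_T)^{-2/3}$. Discounted UCB (D-UCB) with exploration constant $\xi$ selects arm $t$ in slot $t$ for $t\le K$, and in every slot $t>K$ an arm $k$ that maximizes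 $$\hat\mu_t^k+2\sqrt{\frac{\xi\ln\tau}{n_t^k}},\qquad n_t^k=\sum_{s=1}^{t-1}\gamma^{t-s}\mathbf 1\{\varphi_s=k\},\qquad \hat\mu_t^k=\frac1{n_t^k}\sum_{s=1}^{t-1}\gamma^{t-s}\mathbf 1\{\varphi_s=k\}X_s^{\varphi_s},$$ ties being broken by an arbitrary measurable function of the past observations; the version in which the weights $\gamma^{t-s}$ are replaced by $\gamma^{t-1-s}$ is allowed as well. (If $\gamma\le 0$, quotients with denominator $0$ and square roots of negative numbers are read as $0$.) Theorem. For every $\xi>1/2$ and $b>0$ there is a constant $C>0$, depending only on $\xi$ and $b$, such that for all $K\ge1$, $T\ge2$, $a\in\mathbb{R}$ and all $V_T>0$ with $\tau\le T$ (equivalently $V_T\ge\sqrt{K/T}$), the worst-case regret of D-UCB satisfies $$\sup_{\mathcal{E}(V_T,T,K)}R_T^{\text{D-UCB}}\le C\,\ln(T)\,(KV_T)^{1/3}\,T^{2/3}.$$ -/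

import Mathlib

open MeasureTheory ProbabilityTheory

namespace Bandit

noncomputable section

/-- An environment with `K` arms and horizon `T`: one reward distribution for every time slot and
arm. Slots and arms are numbered from `0`. -/
abbrev Environment (K T : ℕ) : Type := Fin T → Fin K → ProbabilityMeasure ℝ

/-- The mean reward of arm `k` in slot `t`. -/
def mean {K T : ℕ} (F : Environment K T) (t : Fin T) (k : Fin K) : ℝ :=
  ∫ y, y ∂(F t k : Measure ℝ)

/-- The mean reward of the best arm in slot `t`. -/
def bestMean {K T : ℕ} (F : Environment K T) (t : Fin T) : ℝ :=
  ⨆ k : Fin K, mean F t k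

/-- The total variation: the sum over consecutive slots of the largest change of a mean. -/
def totalVariation {K T : ℕ} (F : Environment K T) : ℝ :=
  ∑ t : Fin (T - 1), ⨆ k : Fin K,
    |mean F ⟨t + 1, by omega⟩ k - mean F ⟨t, by omega⟩ k|

/-- Every reward is `1/2` sub-Gaussian, that is `E exp (l (X - E X)) ≤ exp (l ^ 2 / 8)` for all
real `l` (variance proxy `1/4`), and every mean lies in `[a, a + b]`. -/
def IsSubGaussianEnv {K T : ℕ} (a b : ℝ) (F : Environment K T) : Prop :=
  ∀ t k, HasSubgaussianMGF (fun y : ℝ => y - mean F t k) (1 / 4) (F t k : Measure ℝ) ∧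
    mean F t k ∈ Set.Icc a (a + b)

/-- The sub-Gaussian environments whose total variation is within the budget `V`. -/
def variationClass (a b V : ℝ) (T K : ℕ) : Set (Environment K T) :=
  {F | IsSubGaussianEnv a b F ∧ totalVariation F ≤ V}

/-- The joint law of all rewards: they are independent, that of arm `k` in slot `t` has
distribution `F t k`. -/
def rewardLaw {K T : ℕ} (F : Environment K T) : Measure (Fin T → Fin K → ℝ) :=
  Measure.pi fun t => Measure.pi fun k => (F t k : Measure ℝ)

/-- A deterministic policy: in slot `t` it selects an arm as a measurable function of the arms
selected and the rewards received in the slots before `t`. -/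
structure Policy (K : ℕ) where
  select : (t : ℕ) → (Fin t → Fin K × ℝ) → Fin K
  measurable_select : ∀ t, Measurable (select t)

/-- The pairs (selected arm, received reward) of the first `t` slots when `x s k` is the reward
that arm `k` offers in slot `s`. -/
def Policy.history {K T : ℕ} (ρ : Policy K) (x : Fin T → Fin K → ℝ) :
    (t : ℕ) → t ≤ T → (Fin t → Fin K × ℝ)
  | 0, _ => Fin.elim0
  | t + 1, h =>
    Fin.snoc (α := fun _ => Fin K × ℝ) (ρ.history x t (Nat.le_of_succ_le h))
      (ρ.select t (ρ.history x t (Nat.le_of_succ_le h)),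
        x ⟨t, h⟩ (ρ.select t (ρ.history x t (Nat.le_of_succ_le h))))

/-- The arm selected in slot `t`. -/
def Policy.arm {K T : ℕ} (ρ : Policy K) (x : Fin T → Fin K → ℝ) (t : Fin T) : Fin K :=
  ρ.select t (ρ.history x t t.2.le)

/-- The regret: total mean reward of the best arms minus expected cumulative reward. -/
def regret {K T : ℕ} (ρ : Policy K) (F : Environment K T) : ℝ :=
  ∑ t, bestMean F t - ∫ x, ∑ t, x t (ρ.arm x t) ∂(rewardLaw F)

/-- The supremum of the regret over the variation budget class. -/
def worstCaseRegret (a b V : ℝ) (T K : ℕ) (ρ : Policy K) : EReal :=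
  ⨆ F ∈ variationClass a b V T K, (regret ρ F : EReal)

/-- The number `τ = ⌈K ^ (1/3) (T / V) ^ (2/3)⌉`. -/
def epochLength (K T : ℕ) (V : ℝ) : ℕ :=
  ⌈(K : ℝ) ^ (1 / 3 : ℝ) * ((T : ℝ) / V) ^ (2 / 3 : ℝ)⌉₊

/-- The discount factor `γ = 1 - K ^ (-1/3) (T / V) ^ (-2/3)`. -/
def discount (K T : ℕ) (V : ℝ) : ℝ :=
  1 - (K : ℝ) ^ (-(1 / 3) : ℝ) * ((T : ℝ) / V) ^ (-(2 / 3) : ℝ)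

/-- The discounted number of selections of arm `k` in a history of `t` slots. The most recent
slot has weight `γ ^ e`: for `e = 1` the weight of slot `s` is `γ ^ (t - s)`, for `e = 0` it is
`γ ^ (t - 1 - s)`, as obtained from the update `n ← γ n`, then `n ← n + 1` for the selected arm. -/
def discountedCount {K : ℕ} (γ : ℝ) (e : ℕ) {t : ℕ} (h : Fin t → Fin K × ℝ) (k : Fin K) : ℝ :=
  ∑ s : Fin t, if (h s).1 = k then γ ^ (t - 1 - s + e) else 0

/-- The discounted empirical average of the rewards received from arm `k`. -/
def discountedMean {K : ℕ} (γ : ℝ) (e : ℕ) {t : ℕ} (h : Fin t → Fin K × ℝ) (k : Fin K) : ℝ :=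
  (∑ s : Fin t, if (h s).1 = k then γ ^ (t - 1 - s + e) * (h s).2 else 0) /
    discountedCount γ e h k

/-- The upper confidence bound of arm `k`: average plus twice the radius `√(ξ ln τ / n)`. -/
def ucbIndex {K : ℕ} (γ : ℝ) (e : ℕ) (ξ : ℝ) (τ : ℕ) {t : ℕ} (h : Fin t → Fin K × ℝ)
    (k : Fin K) : ℝ :=
  discountedMean γ e h k + 2 * √(ξ * Real.log τ / discountedCount γ e h k)

/-- `ρ` is Discounted UCB for `K` arms, horizon `T`, variation budget `V` and exploration
constant `ξ`: it selects every arm once in the first `K` slots, arm `t` in slot `t`, and an arm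
of maximal index in every later slot (ties are broken arbitrarily). -/
def IsDUCB {K : ℕ} (T : ℕ) (V ξ : ℝ) (e : ℕ) (ρ : Policy K) : Prop :=
  ∀ t < T, ∀ h : Fin t → Fin K × ℝ,
    (t < K → (ρ.select t h : ℕ) = t) ∧
    (K ≤ t → ∀ k, ucbIndex (discount K T V) e ξ (epochLength K T V) h k ≤
      ucbIndex (discount K T V) e ξ (epochLength K T V) h (ρ.select t h))

end

end Bandit

/-! Put d = 1 - γ. The rate M = (K V)^(1/3) T^(2/3) equals both V / d, the price of drift, and T √(K
d), the price of estimation (`rate_eq`). If √(K d) ≥ 1/8, the trivial bound b T is already of order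
M, so K d may be taken small.

The regret is the expected sum of the gaps (`regret_eq_integral`), and the gap of an arm of maximal
index is bounded path by path (`gap_le_of_ucbIndex_le`) by three terms. The first is the drift over
a window of about (1/d) ln(1/d) slots; older slots carry negligible weight, and summing over time
costs window length times V. The second is a confidence radius of order √(ξ ln τ) / √(n + 1), summed
by means of the potential ∑ √n_k (`sum_inv_sqrt_discountedCount_le`), which yields T √(K d). The
third is a penalty b on the event that the noise of some arm is too large.

For the third term, let S be the discounted noise of an arm and Q the sum of its squared weights.
The count n is random and depends on the policy, but exp(θ S - θ² Q / 8) has expectation at most 1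
for each fixed θ (`lintegral_exp_noise_le`). A grid of values of θ, indexed by the integer part of n
or of 1/n, handles all n at once (`one_le_deviationSum`). Since Q ≤ min(n, n²), the expected sum
over the grid is O(1/τ) (`sum_exp_grid_le`), so failures cost O(b T K / τ), which is O(b M). -/

namespace Bandit

/-! ### Resampling one coordinate of a product measure -/

section Resampling

/-- Replacing one coordinate of a product measure by an independent copy does not change it. -/
theorem measurePreserving_update {ι : Type*} [Fintype ι] [DecidableEq ι] {Ω : ι → Type*}
    [∀ i, MeasurableSpace (Ω i)] (μ : ∀ i, Measure (Ω i)) [∀ i, IsProbabilityMeasure (μ i)]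
    (i : ι) :
    MeasurePreserving (fun p : (∀ j, Ω j) × Ω i => Function.update p.1 i p.2)
      ((Measure.pi μ).prod (μ i)) (Measure.pi μ) := by
  have hm : Measurable (fun p : (∀ j, Ω j) × Ω i => Function.update p.1 i p.2) := by
    refine measurable_pi_iff.2 fun j => ?_
    by_cases h : j = i
    · subst h
      simpa using measurable_snd
    · simp only [Function.update_of_ne h]
      exact (measurable_pi_apply j).comp measurable_fst
  refine ⟨hm, (Measure.pi_eq fun s hs => ?_).symm⟩
  rw [Measure.map_apply hm (MeasurableSet.univ_pi hs)]
  have : (fun p : (∀ j, Ω j) × Ω i => Function.update p.1 i p.2) ⁻¹' Set.univ.pi s =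
      (Set.univ.pi (Function.update s i Set.univ)) ×ˢ s i := by
    ext p
    simp only [Set.mem_preimage, Set.mem_pi, Set.mem_univ, true_imp_iff, Set.mem_prod]
    constructor
    · intro h
      refine ⟨fun j => ?_, by simpa using h i⟩
      by_cases hj : j = i
      · subst hj; simp
      · simpa [Function.update_of_ne hj] using h j
    · rintro ⟨h, h'⟩ j
      by_cases hj : j = i
      · subst hj; simpa using h'
      · simpa [Function.update_of_ne hj] using h j
  rw [this, Measure.prod_prod, Measure.pi_pi,
    ← Finset.mul_prod_erase _ _ (Finset.mem_univ i),
    ← Finset.mul_prod_erase (a := i) Finset.univ (fun j => μ j (s j)) (Finset.mem_univ i)]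
  have : ∏ x ∈ Finset.univ.erase i, μ x (Function.update s i Set.univ x) =
      ∏ x ∈ Finset.univ.erase i, μ x (s x) :=
    Finset.prod_congr rfl fun j hj => by
      rw [Function.update_of_ne (Finset.ne_of_mem_erase hj)]
  rw [this]
  simp [mul_comm]

end Resampling

/-! ### Causality and measurability of the policy -/

section Path

variable {K T : ℕ} (ρ : Policy K)

theorem Policy.history_apply (x : Fin T → Fin K → ℝ) :
    ∀ (t : ℕ) (ht : t ≤ T) (s : Fin t), ρ.history x t ht s =
      (ρ.arm x (s.castLE ht), x (s.castLE ht) (ρ.arm x (s.castLE ht)))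
  | 0, _, s => s.elim0
  | t + 1, ht, s => by
    induction s using Fin.lastCases with
    | last =>
      simp only [Policy.history, Fin.snoc_last]
      rfl
    | cast s =>
      have := Policy.history_apply x t (Nat.le_of_succ_le ht) s
      simpa [Policy.history] using this

theorem Policy.history_update (x : Fin T → Fin K → ℝ) (u : Fin T) (y : Fin K → ℝ) :
    ∀ (t : ℕ) (ht : t ≤ T), t ≤ u → ρ.history (Function.update x u y) t ht = ρ.history x t ht
  | 0, _, _ => rfl
  | t + 1, ht, hu => by
    have ih := Policy.history_update x u y t (Nat.le_of_succ_le ht) (Nat.le_of_succ_le hu)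
    have hne : (⟨t, ht⟩ : Fin T) ≠ u := fun h => by
      have := congrArg Fin.val h
      simp only at this
      omega
    simp only [Policy.history, ih, Function.update_of_ne hne]

theorem Policy.arm_update (x : Fin T → Fin K → ℝ) (u : Fin T) (y : Fin K → ℝ) (t : Fin T)
    (h : t ≤ u) : ρ.arm (Function.update x u y) t = ρ.arm x t := by
  simp only [Policy.arm, ρ.history_update x u y t _ h]

theorem Policy.measurable_history :
    ∀ (t : ℕ) (ht : t ≤ T), Measurable fun x : Fin T → Fin K → ℝ => ρ.history x t ht
  | 0, _ => measurable_const
  | t + 1, ht => by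
    have ih := Policy.measurable_history t (Nat.le_of_succ_le ht)
    have hs := (ρ.measurable_select t).comp ih
    refine measurable_pi_iff.2 fun s => ?_
    induction s using Fin.lastCases with
    | last =>
      simp only [Policy.history, Fin.snoc_last]
      refine hs.prodMk ?_
      have : Measurable fun p : (Fin K → ℝ) × Fin K => p.1 p.2 :=
        measurable_from_prod_countable_left fun k => measurable_pi_apply k
      exact this.comp ((measurable_pi_apply (⟨t, ht⟩ : Fin T)).prodMk hs)
    | cast s =>
      simp only [Policy.history, Fin.snoc_castSucc]
      exact (measurable_pi_apply s).comp ih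

theorem Policy.measurable_arm (t : Fin T) :
    Measurable fun x : Fin T → Fin K → ℝ => ρ.arm x t :=
  (ρ.measurable_select t).comp (ρ.measurable_history t t.2.le)

theorem Policy.measurableSet_arm_eq (t : Fin T) (k : Fin K) :
    MeasurableSet {x : Fin T → Fin K → ℝ | ρ.arm x t = k} :=
  ρ.measurable_arm t (measurableSet_singleton k)

end Path

/-! ### Regret as expected gaps; exponential moments of the noise -/

section Expectation

variable {K T : ℕ} (F : Environment K T)

instance : IsProbabilityMeasure (rewardLaw F) := by
  unfold rewardLaw; infer_instance

/-- This stands in for conditioning on the past: decisions up to and including slot u do not see the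
rewards of slot u, so they are constant in the inner integral. -/
theorem lintegral_resample (u : Fin T) {f : (Fin T → Fin K → ℝ) → ENNReal} (hf : Measurable f) :
    ∫⁻ x, f x ∂(rewardLaw F) = ∫⁻ x, ∫⁻ y, f (Function.update x u y)
      ∂(Measure.pi fun k => (F u k : Measure ℝ)) ∂(rewardLaw F) := by
  have h := measurePreserving_update (fun t => Measure.pi fun k => (F t k : Measure ℝ)) u
  have h2 := h.lintegral_comp hf
  rw [lintegral_prod (fun p => f (Function.update p.1 u p.2))
    (hf.comp h.measurable).aemeasurable] at h2
  exact h2.symm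

theorem integral_resample (u : Fin T) {f : (Fin T → Fin K → ℝ) → ℝ}
    (hf : Integrable f (rewardLaw F)) :
    ∫ x, f x ∂(rewardLaw F) = ∫ x, ∫ y, f (Function.update x u y)
      ∂(Measure.pi fun k => (F u k : Measure ℝ)) ∂(rewardLaw F) := by
  have h := measurePreserving_update (fun t => Measure.pi fun k => (F t k : Measure ℝ)) u
  have h2 := integral_map (f := f) h.measurable.aemeasurable
    (by rw [h.map_eq]; exact hf.aestronglyMeasurable)
  rw [h.map_eq, integral_prod (fun p => f (Function.update p.1 u p.2))
    (h.integrable_comp_of_integrable hf)] at h2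
  exact h2

variable {F} {a b : ℝ} (hF : IsSubGaussianEnv a b F) (ρ : Policy K)
include hF

theorem integrable_id_of_isSubGaussianEnv (t : Fin T) (k : Fin K) :
    Integrable (fun y : ℝ => y) (F t k : Measure ℝ) := by
  have := (hF t k).1.integrable.add (integrable_const (mean F t k))
  refine this.congr (Filter.Eventually.of_forall fun y => ?_)
  simp

theorem integrable_reward (t : Fin T) :
    Integrable (fun x => x t (ρ.arm x t)) (rewardLaw F) := by
  have h1 : ∀ k, Integrable (fun x : Fin T → Fin K → ℝ => x t k) (rewardLaw F) := fun k =>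
    integrable_comp_eval (μ := fun t => Measure.pi fun k => (F t k : Measure ℝ)) (i := t)
      (f := fun y : Fin K → ℝ => y k)
      (integrable_comp_eval (μ := fun k => (F t k : Measure ℝ)) (i := k) (f := fun y => y)
        (integrable_id_of_isSubGaussianEnv hF t k))
  have h2 := integrable_finsetSum (Finset.univ : Finset (Fin K)) fun k _ =>
    (h1 k).indicator (ρ.measurableSet_arm_eq t k)
  refine h2.congr (Filter.Eventually.of_forall fun x => ?_)
  simp [Set.indicator_apply]

theorem integral_reward (t : Fin T) :
    ∫ x, x t (ρ.arm x t) ∂(rewardLaw F) = ∫ x, mean F t (ρ.arm x t) ∂(rewardLaw F) := by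
  rw [integral_resample F t (integrable_reward hF ρ t)]
  refine integral_congr_ae (Filter.Eventually.of_forall fun x => ?_)
  simp only [ρ.arm_update x t _ t le_rfl, Function.update_self]
  exact integral_comp_eval (μ := fun k => (F t k : Measure ℝ)) (f := fun y => y)
    (integrable_id_of_isSubGaussianEnv hF t _).aestronglyMeasurable

theorem integrable_mean_arm (t : Fin T) :
    Integrable (fun x => mean F t (ρ.arm x t)) (rewardLaw F) := by
  have hm : Measurable fun x : Fin T → Fin K → ℝ => mean F t (ρ.arm x t) :=
    (measurable_of_countable (mean F t)).comp (ρ.measurable_arm t)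
  refine Integrable.of_mem_Icc a (a + b) hm.aemeasurable
    (Filter.Eventually.of_forall fun x => (hF t _).2)

/-- The regret is the expected sum of the gaps of the selected arms. -/
theorem regret_eq_integral :
    regret ρ F = ∫ x, ∑ t, (bestMean F t - mean F t (ρ.arm x t)) ∂(rewardLaw F) := by
  have h := integrable_mean_arm hF ρ
  rw [regret, integral_finsetSum _ fun t _ => integrable_reward hF ρ t,
    integral_finsetSum (f := fun t x => bestMean F t - mean F t (ρ.arm x t)) _
      fun t _ => (integrable_const _).sub (h t), ← Finset.sum_sub_distrib]
  refine Finset.sum_congr rfl fun t _ => ?_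
  rw [integral_reward hF ρ t, integral_sub (integrable_const _) (h t)]
  simp

theorem lintegral_exp_centered_le (t : Fin T) (k : Fin K) (l : ℝ) :
    ∫⁻ y, ENNReal.ofReal (Real.exp (l * (y - mean F t k) - l ^ 2 / 8)) ∂(F t k : Measure ℝ)
      ≤ 1 := by
  have h := (hF t k).1
  have hi := h.integrable_exp_mul l
  have hm := h.mgf_le l
  have e : ∀ y : ℝ, Real.exp (l * (y - mean F t k) - l ^ 2 / 8) =
      Real.exp (l * (y - mean F t k)) * Real.exp (- (l ^ 2 / 8)) := fun y => by
    rw [← Real.exp_add]; ring_nf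
  simp only [e]
  rw [← ofReal_integral_eq_lintegral_ofReal (hi.mul_const _)
    (Filter.Eventually.of_forall fun y => by positivity), integral_mul_const]
  refine ENNReal.ofReal_le_one.2 ?_
  calc _ ≤ Real.exp (((1 / 4 : NNReal) : ℝ) * l ^ 2 / 2) * Real.exp (-(l ^ 2 / 8)) :=
        mul_le_mul_of_nonneg_right hm (Real.exp_pos _).le
    _ = 1 := by
        rw [← Real.exp_add, Real.exp_eq_one_iff]
        push_cast
        ring

/-- The exponential process of the weighted noise of an arm, with deterministic weights `c`, has
expectation at most one. -/
theorem lintegral_exp_noise_le (k : Fin K) (c : ℕ → ℝ) :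
    ∀ (t : ℕ) (ht : t ≤ T), ∫⁻ x, ENNReal.ofReal (Real.exp (∑ s : Fin t,
      if ρ.arm x (s.castLE ht) = k then
        c s * (x (s.castLE ht) k - mean F (s.castLE ht) k) - c s ^ 2 / 8 else 0))
      ∂(rewardLaw F) ≤ 1
  | 0, _ => by simp
  | t + 1, ht => by
    have hm : ∀ (u : ℕ) (hu : u ≤ T), Measurable fun x : Fin T → Fin K → ℝ =>
        ENNReal.ofReal (Real.exp (∑ s : Fin u, if ρ.arm x (s.castLE hu) = k then
        c s * (x (s.castLE hu) k - mean F (s.castLE hu) k) - c s ^ 2 / 8 else 0)) := by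
      intro u hu
      refine (Real.measurable_exp.comp (Finset.measurable_sum _ fun s _ => ?_)).ennreal_ofReal
      refine Measurable.ite (ρ.measurableSet_arm_eq _ _) ?_ measurable_const
      fun_prop
    have ih := lintegral_exp_noise_le k c t (Nat.le_of_succ_le ht)
    refine le_trans ?_ ih
    -- Integrate the rewards of the last slot first. All earlier factors and the arm of slot t stay
    -- fixed; the last factor integrates to at most 1 if that arm is k, and is 1 otherwise.
    rw [lintegral_resample F ⟨t, ht⟩ (hm (t + 1) ht)]
    refine lintegral_mono fun x => ?_
    have e1 : ∀ (y : Fin K → ℝ) (s : Fin t),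
        ρ.arm (Function.update x ⟨t, ht⟩ y) (s.castLE (Nat.le_of_succ_le ht)) =
          ρ.arm x (s.castLE (Nat.le_of_succ_le ht)) := fun y s =>
      ρ.arm_update x _ y _ (Fin.le_def.2 s.2.le)
    have e2 : ∀ (y : Fin K → ℝ) (s : Fin t),
        Function.update x ⟨t, ht⟩ y (s.castLE (Nat.le_of_succ_le ht)) =
          x (s.castLE (Nat.le_of_succ_le ht)) := fun y s =>
      Function.update_of_ne (fun h => by
        have := congrArg Fin.val h
        have := s.2
        simp at *
        omega) _ _
    have e3 : (Fin.last t).castLE ht = ⟨t, ht⟩ := rfl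
    simp only [Fin.sum_univ_castSucc, Fin.castLE_castSucc, e1, e2, e3,
      ρ.arm_update x _ _ _ le_rfl, Function.update_self, Fin.val_castSucc, Fin.val_last,
      Real.exp_add, ENNReal.ofReal_mul (Real.exp_pos _).le]
    split_ifs with hk
    · rw [lintegral_const_mul _ (by fun_prop)]
      refine mul_le_of_le_one_right zero_le ?_
      have hp := (measurePreserving_eval (fun k => (F ⟨t, ht⟩ k : Measure ℝ)) k).lintegral_comp
        (f := fun y => ENNReal.ofReal
          (Real.exp (c t * (y - mean F ⟨t, ht⟩ k) - c t ^ 2 / 8))) (by fun_prop)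
      refine le_trans (le_of_eq ?_) (lintegral_exp_centered_le hF ⟨t, ht⟩ k (c t))
      exact hp
    · simp

end Expectation

/-! ### Self-normalized deviations via a grid of exponential parameters -/

section Deviation

/-- The two-sided exponential weight: it exceeds one as soon as `|S| > r / θ + θ V / 8`. -/
noncomputable def deviationWeight (θ r S V : ℝ) : ℝ :=
  Real.exp (-r) * (Real.exp (θ * S - θ ^ 2 * V / 8) + Real.exp ((-θ) * S - θ ^ 2 * V / 8))

theorem deviationWeight_nonneg (θ r S V : ℝ) : 0 ≤ deviationWeight θ r S V := by
  unfold deviationWeight; positivity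

theorem one_le_deviationWeight {θ r S V : ℝ} (hθ : 0 < θ) (h : r / θ + θ * V / 8 ≤ |S|) :
    1 ≤ deviationWeight θ r S V := by
  have h1 : 0 ≤ θ * |S| - θ ^ 2 * V / 8 - r := by
    have h2 := mul_le_mul_of_nonneg_left h hθ.le
    have h3 : θ * (r / θ + θ * V / 8) = r + θ ^ 2 * V / 8 := by field_simp
    linarith
  have h4 : 1 ≤ Real.exp (-r) * Real.exp (θ * |S| - θ ^ 2 * V / 8) := by
    rw [← Real.exp_add]
    exact Real.one_le_exp (by linarith)
  refine h4.trans (mul_le_mul_of_nonneg_left ?_ (Real.exp_pos _).le)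
  rcases abs_choice S with hS | hS <;> rw [hS]
  · exact le_add_of_nonneg_right (Real.exp_pos _).le
  · rw [mul_neg, neg_mul]
    exact le_add_of_nonneg_left (Real.exp_pos _).le

/-- For V = n the optimal θ is 4 √(L / n), with threshold √(L n). Rounding n down to an integer
makes θ deterministic on each cell; the factor 5/4 absorbs the loss. -/
theorem one_le_deviationWeight_of_one_le {L n S V : ℝ} (hL : 0 < L) (hn : 1 ≤ n) (hV : V ≤ n)
    (hS : 5 / 4 * √(L * n) ≤ |S|) :
    1 ≤ deviationWeight (4 * √(L / ⌊n⌋₊)) (2 * L) S V := by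
  have hm : (1 : ℝ) ≤ ⌊n⌋₊ := by exact_mod_cast Nat.le_floor (by simpa using hn)
  have hm1 : (⌊n⌋₊ : ℝ) ≤ n := Nat.floor_le (by linarith)
  have hm2 : n ≤ 2 * ⌊n⌋₊ := by linarith [Nat.lt_floor_add_one n]
  generalize (⌊n⌋₊ : ℝ) = m at *
  have hl : 0 < √L := Real.sqrt_pos.2 hL
  have hp : 0 < √m := Real.sqrt_pos.2 (by linarith)
  have hz : √m ≤ √n := Real.sqrt_le_sqrt hm1
  have hL2 : √L ^ 2 = L := Real.sq_sqrt hL.le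
  have hp2 : √m ^ 2 = m := Real.sq_sqrt (by linarith)
  have hz2 : √n ^ 2 = n := Real.sq_sqrt (by linarith)
  rw [Real.sqrt_mul hL.le] at hS
  rw [Real.sqrt_div hL.le]
  refine one_le_deviationWeight (by positivity) (le_trans ?_ hS)
  generalize √L = l at *
  generalize √m = p at *
  generalize √n = z at *
  have e : 2 * L / (4 * (l / p)) + 4 * (l / p) * V / 8 = l * ((p ^ 2 + V) / (2 * p)) := by
    rw [← hL2]; field_simp; ring
  rw [e, show 5 / 4 * (l * z) = l * (5 / 4 * z) by ring]
  refine mul_le_mul_of_nonneg_left ?_ hl.le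
  rw [div_le_iff₀ (by positivity)]
  -- From n ≤ 2 ⌊n⌋ and √2 ≤ 3/2. Then p² ≤ p z and z² ≤ (3/2) p z add up to (5/2) p z.
  have h32 : z ≤ 3 / 2 * p := by nlinarith
  nlinarith [mul_le_mul_of_nonneg_left h32 (hp.le.trans hz), mul_le_mul_of_nonneg_left hz hp.le]

/-- For small n the bound V ≤ n² beats V ≤ n: the affordable exponent r grows linearly in m = ⌊1/n⌋.
This θ balances r / θ against θ V / 8, because m² V ≤ 1. -/
theorem one_le_deviationWeight_of_lt_one {L n S V : ℝ} (hL : 0 < L) (hn0 : 0 < n) (hn : n < 1)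
    (hV : V ≤ n ^ 2) (hS : 5 / 4 * √(L * n) ≤ |S|) :
    1 ≤ deviationWeight (2 * ⌊1 / n⌋₊ * √((⌊1 / n⌋₊ + 1) * L))
      ((⌊1 / n⌋₊ + 1) / 2 * L) S V := by
  have h1n : 1 ≤ 1 / n := by rw [le_div_iff₀ hn0]; linarith
  have hm : (1 : ℝ) ≤ ⌊1 / n⌋₊ := by exact_mod_cast Nat.le_floor (by simpa using h1n)
  have hm1 : (⌊1 / n⌋₊ : ℝ) * n ≤ 1 := by
    have := Nat.floor_le (show 0 ≤ 1 / n by positivity)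
    rwa [le_div_iff₀ hn0] at this
  have hm2 : 1 ≤ (⌊1 / n⌋₊ + 1 : ℝ) * n := by
    have := (Nat.lt_floor_add_one (1 / n)).le
    rwa [div_le_iff₀ hn0] at this
  generalize (⌊1 / n⌋₊ : ℝ) = m at *
  have hl : 0 < √L := Real.sqrt_pos.2 hL
  have hq : 0 < √(m + 1) := Real.sqrt_pos.2 (by linarith)
  have hL2 : √L ^ 2 = L := Real.sq_sqrt hL.le
  have hq2 : √(m + 1) ^ 2 = m + 1 := Real.sq_sqrt (by linarith)
  have hz : 1 ≤ √(m + 1) * √n := by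
    rw [← Real.sqrt_mul (by linarith)]
    exact Real.one_le_sqrt.2 hm2
  have hz0 : 0 ≤ √n := Real.sqrt_nonneg n
  rw [Real.sqrt_mul hL.le] at hS
  rw [Real.sqrt_mul (by linarith)]
  refine one_le_deviationWeight (by positivity) (le_trans ?_ hS)
  generalize √L = l at *
  generalize √(m + 1) = q at *
  generalize √n = z at *
  have e : (m + 1) / 2 * L / (2 * m * (q * l)) + 2 * m * (q * l) * V / 8 =
      l * (q * ((1 + m ^ 2 * V) / (4 * m))) := by
    rw [← hL2, ← hq2]; field_simp; ring
  rw [e, show 5 / 4 * (l * z) = l * (5 / 4 * z) by ring]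
  refine mul_le_mul_of_nonneg_left ?_ hl.le
  have hmV : m ^ 2 * V ≤ 1 := by
    calc m ^ 2 * V ≤ m ^ 2 * n ^ 2 := mul_le_mul_of_nonneg_left hV (by positivity)
      _ = (m * n) ^ 2 := by ring
      _ ≤ 1 := pow_le_one₀ (by positivity) hm1
  calc q * ((1 + m ^ 2 * V) / (4 * m)) ≤ q * (2 / (4 * m)) := by gcongr; linarith
    _ ≤ q * (2 / (4 * m)) * (q * z) := le_mul_of_one_le_right (by positivity) hz
    _ = z * ((m + 1) / (2 * m)) := by rw [← hq2]; field_simp; ring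
    _ ≤ z * (5 / 4) := by
        refine mul_le_mul_of_nonneg_left ?_ hz0
        rw [div_le_iff₀ (by positivity)]
        linarith
    _ = 5 / 4 * z := by ring

/-- The sum of the exponential weights over a grid of parameters that covers all values of the
discounted count between `1 / N` and `τ`. -/
noncomputable def deviationSum (τ N : ℕ) (S V : ℝ) : ℝ :=
  ∑ m ∈ Finset.Icc 1 τ, deviationWeight (4 * √(Real.log τ / m)) (2 * Real.log τ) S V +
    ∑ m ∈ Finset.Icc 1 N, deviationWeight (2 * m * √((m + 1) * Real.log τ))
      ((m + 1) / 2 * Real.log τ) S V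

theorem deviationSum_nonneg (τ N : ℕ) (S V : ℝ) : 0 ≤ deviationSum τ N S V :=
  add_nonneg (Finset.sum_nonneg fun _ _ => deviationWeight_nonneg _ _ _ _)
    (Finset.sum_nonneg fun _ _ => deviationWeight_nonneg _ _ _ _)

theorem one_le_deviationSum {τ N : ℕ} {n S V : ℝ} (hτ : 2 ≤ τ) (hn0 : 0 < n) (hn : n ≤ τ)
    (hN : 1 / n ≤ N) (hV : V ≤ n) (hV2 : V ≤ n ^ 2) (hS : 5 / 4 * √(Real.log τ * n) ≤ |S|) :
    1 ≤ deviationSum τ N S V := by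
  have hL : 0 < Real.log τ := Real.log_pos (by exact_mod_cast hτ)
  rcases le_or_gt 1 n with h1 | h1
  · have hm : ⌊n⌋₊ ∈ Finset.Icc 1 τ := Finset.mem_Icc.2
      ⟨Nat.le_floor (by simpa using h1), Nat.floor_le_of_le hn⟩
    calc 1 ≤ _ := one_le_deviationWeight_of_one_le hL h1 hV hS
      _ ≤ _ := Finset.single_le_sum
          (f := fun m : ℕ => deviationWeight (4 * √(Real.log τ / m)) (2 * Real.log τ) S V)
          (fun _ _ => deviationWeight_nonneg _ _ _ _) hm
      _ ≤ _ := le_add_of_nonneg_right (Finset.sum_nonneg fun _ _ =>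
          deviationWeight_nonneg _ _ _ _)
  · have h1n : 1 ≤ 1 / n := by rw [le_div_iff₀ hn0]; linarith
    have hm : ⌊1 / n⌋₊ ∈ Finset.Icc 1 N := Finset.mem_Icc.2
      ⟨Nat.le_floor (by simpa using h1n), Nat.floor_le_of_le hN⟩
    calc 1 ≤ _ := one_le_deviationWeight_of_lt_one hL hn0 h1 hV2 hS
      _ ≤ _ := Finset.single_le_sum
          (f := fun m : ℕ => deviationWeight (2 * m * √((m + 1) * Real.log τ))
            ((m + 1) / 2 * Real.log τ) S V)
          (fun _ _ => deviationWeight_nonneg _ _ _ _) hm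
      _ ≤ _ := le_add_of_nonneg_left (Finset.sum_nonneg fun _ _ =>
          deviationWeight_nonneg _ _ _ _)

/-- The first sum is τ terms of size τ⁻². The second is geometric with ratio q = τ^(-1/2), at most
1/2 because τ ≥ 4, and starts at q² = 1/τ; hence the bound is free of N. -/
theorem sum_exp_grid_le {τ : ℕ} (N : ℕ) (hτ : 4 ≤ τ) :
    ∑ _m ∈ Finset.Icc 1 τ, Real.exp (-(2 * Real.log τ)) +
      ∑ m ∈ Finset.Icc 1 N, Real.exp (-(((m : ℝ) + 1) / 2 * Real.log τ)) ≤ 3 / τ := by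
  have hτ0 : (0 : ℝ) < τ := by positivity
  have hτ4 : (4 : ℝ) ≤ τ := by exact_mod_cast hτ
  have h1 : ∑ _m ∈ Finset.Icc 1 τ, Real.exp (-(2 * Real.log τ)) = 1 / τ := by
    rw [Finset.sum_const, Nat.card_Icc, Nat.add_sub_cancel, nsmul_eq_mul,
      show -(2 * Real.log τ) = -Real.log τ + -Real.log τ by ring, Real.exp_add, Real.exp_neg,
      Real.exp_log hτ0]
    field_simp
  set q : ℝ := Real.exp (-(Real.log τ / 2)) with hq
  have hq0 : 0 < q := Real.exp_pos _
  have hq2 : q * q = 1 / τ := by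
    rw [hq, ← Real.exp_add, show -(Real.log τ / 2) + -(Real.log τ / 2) = -Real.log τ by ring,
      Real.exp_neg, Real.exp_log hτ0, one_div]
  have hq12 : q ≤ 1 / 2 := by
    have : q * q ≤ 1 / 4 := by rw [hq2]; exact one_div_le_one_div_of_le (by norm_num) hτ4
    nlinarith
  have h2 : ∀ m : ℕ, Real.exp (-(((m : ℝ) + 1) / 2 * Real.log τ)) = q * q ^ m := fun m => by
    rw [hq, ← Real.exp_nat_mul, ← Real.exp_add]
    ring_nf
  have h3 : ∑ m ∈ Finset.Icc 1 N, q ^ m ≤ q ^ 1 / (1 - q) := by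
    have := geom_sum_Ico_le_of_lt_one (m := 1) (n := N + 1) hq0.le (by linarith)
    exact this
  have h4 : q ^ 1 / (1 - q) ≤ 2 * q := by
    rw [div_le_iff₀ (by linarith)]
    nlinarith
  rw [h1]
  simp only [h2]
  rw [← Finset.mul_sum]
  calc 1 / (τ : ℝ) + q * ∑ m ∈ Finset.Icc 1 N, q ^ m ≤ 1 / τ + q * (2 * q) := by
        gcongr; exact h3.trans h4
    _ = 1 / τ + 2 * (q * q) := by ring
    _ = 3 / τ := by rw [hq2]; ring

end Deviation

/-! ### Bias caused by old observations -/

section Bias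

/-- The old weight O is bounded both by the total weight and by (8b)⁻², so b O = b √O √O is at most
an eighth of the square root of the total. The old bias thus fits into a confidence radius, however
small the total weight. -/
theorem abs_sum_mul_sub_le {ι : Type*} (I : Finset ι) (w μ : ι → ℝ) (old : ι → Prop)
    [DecidablePred old] {m v b : ℝ} (hb : 0 < b) (hv : 0 ≤ v) (hw : ∀ i ∈ I, 0 ≤ w i)
    (hnew : ∀ i ∈ I, ¬ old i → |μ i - m| ≤ v) (hall : ∀ i ∈ I, |μ i - m| ≤ b)
    (hold : ∑ i ∈ I with old i, w i ≤ 1 / (64 * b ^ 2)) :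
    |∑ i ∈ I, w i * (μ i - m)| ≤ v * ∑ i ∈ I, w i + √(∑ i ∈ I, w i) / 8 := by
  set O := ∑ i ∈ I with old i, w i with hO
  have hO0 : 0 ≤ O := Finset.sum_nonneg fun i hi => hw i (Finset.mem_filter.1 hi).1
  have hOn : O ≤ ∑ i ∈ I, w i :=
    Finset.sum_le_sum_of_subset_of_nonneg (Finset.filter_subset _ _) fun i hi _ => hw i hi
  have h1 : |∑ i ∈ I, w i * (μ i - m)| ≤ v * ∑ i ∈ I, w i + b * O := by
    refine (Finset.abs_sum_le_sum_abs _ _).trans ?_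
    rw [hO, Finset.sum_filter, Finset.mul_sum, Finset.mul_sum, ← Finset.sum_add_distrib]
    refine Finset.sum_le_sum fun i hi => ?_
    rw [abs_mul, abs_of_nonneg (hw i hi)]
    have hwi := hw i hi
    split_ifs with h
    · nlinarith [mul_le_mul_of_nonneg_left (hall i hi) hwi, mul_nonneg hv hwi]
    · nlinarith [mul_le_mul_of_nonneg_left (hnew i hi h) hwi]
  have h2 : b * O ≤ √(∑ i ∈ I, w i) / 8 := by
    have h3 : √O ≤ 1 / (8 * b) := by
      rw [Real.sqrt_le_left (by positivity)]
      refine hold.trans (le_of_eq ?_)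
      field_simp; ring
    calc b * O = b * (√O * √O) := by rw [Real.mul_self_sqrt hO0]
      _ ≤ b * (√(∑ i ∈ I, w i) * (1 / (8 * b))) := by gcongr
      _ = _ := by field_simp
  linarith

theorem sum_old_weight_le {γ : ℝ} (hγ0 : 0 ≤ γ) (hγ1 : γ < 1) (D t : ℕ) :
    ∑ s : Fin t with s.1 + D < t, γ ^ (t - 1 - s.1) ≤ γ ^ D / (1 - γ) := by
  rw [Finset.sum_filter,
    Fin.sum_univ_eq_sum_range (fun s => if s + D < t then γ ^ (t - 1 - s) else 0) t,
    ← Finset.sum_range_reflect]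
  have h : ∀ j ∈ Finset.range t, (if t - 1 - j + D < t then γ ^ (t - 1 - (t - 1 - j)) else 0) =
      if D ≤ j then γ ^ j else 0 := fun j hj => by
    have := Finset.mem_range.1 hj
    rw [show t - 1 - (t - 1 - j) = j by omega]
    by_cases hD : D ≤ j
    · rw [if_pos hD, if_pos (by omega)]
    · rw [if_neg hD, if_neg (by omega)]
  rw [Finset.sum_congr rfl h, ← Finset.sum_filter]
  refine le_trans (le_of_eq (Finset.sum_congr ?_ fun _ _ => rfl))
    (geom_sum_Ico_le_of_lt_one (m := D) (n := t) hγ0 hγ1)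
  ext j
  simp [and_comm]

end Bias

/-! ### Drift of the means over a sliding window -/

section Variation

variable {K T : ℕ} (F : Environment K T)

/-- The largest change of a mean from slot `u` to slot `u + 1`. -/
noncomputable def variation (u : ℕ) : ℝ :=
  if h : u + 1 < T then ⨆ k : Fin K, |mean F ⟨u + 1, h⟩ k - mean F ⟨u, by omega⟩ k| else 0

theorem variation_nonneg (u : ℕ) : 0 ≤ variation F u := by
  unfold variation
  split_ifs
  · exact Real.iSup_nonneg fun _ => abs_nonneg _
  · exact le_rfl

theorem sum_variation : ∑ u ∈ Finset.range (T - 1), variation F u = totalVariation F := by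
  rw [totalVariation, ← Fin.sum_univ_eq_sum_range]
  refine Finset.sum_congr rfl fun u _ => ?_
  rw [variation, dif_pos (by omega)]

theorem abs_mean_sub_le (k : Fin K) (s : ℕ) :
    ∀ (t : ℕ) (hst : s ≤ t) (ht : t < T), |mean F ⟨s, by omega⟩ k - mean F ⟨t, ht⟩ k| ≤
      ∑ u ∈ Finset.Ico s t, variation F u := by
  intro t hst
  induction t, hst using Nat.le_induction with
  | base => intro ht; simp
  | succ t hst ih =>
    intro ht
    rw [Finset.sum_Ico_succ_top hst]
    have h1 := ih (by omega)
    have h2 : |mean F ⟨t, by omega⟩ k - mean F ⟨t + 1, ht⟩ k| ≤ variation F t := by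
      rw [variation, dif_pos ht, abs_sub_comm]
      exact le_ciSup (f := fun k => |mean F ⟨t + 1, ht⟩ k - mean F ⟨t, by omega⟩ k|)
        (Finite.bddAbove_range _) k
    exact (abs_sub_le _ (mean F ⟨t, by omega⟩ k) _).trans (add_le_add h1 h2)

/-- The variation during the `D` slots before slot `t`. -/
noncomputable def windowVariation (D t : ℕ) : ℝ := ∑ u ∈ Finset.Ico (t - D) t, variation F u

theorem windowVariation_nonneg (D t : ℕ) : 0 ≤ windowVariation F D t :=
  Finset.sum_nonneg fun _ _ => variation_nonneg F _

theorem abs_mean_sub_le_windowVariation (k : Fin K) {D : ℕ} {s t : Fin T} (hst : s ≤ t)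
    (h : t.1 ≤ s + D) : |mean F s k - mean F t k| ≤ windowVariation F D t := by
  refine (abs_mean_sub_le F k s t hst t.2).trans ?_
  exact Finset.sum_le_sum_of_subset_of_nonneg
    (Finset.Ico_subset_Ico_left (by omega)) fun _ _ _ => variation_nonneg F _

theorem sum_windowVariation_le (D : ℕ) :
    ∑ t : Fin T, windowVariation F D t ≤ D * totalVariation F := by
  rw [Fin.sum_univ_eq_sum_range (windowVariation F D) T, ← sum_variation, Finset.mul_sum]
  have h1 : ∀ t ∈ Finset.range T, windowVariation F D t = ∑ u ∈ Finset.range (T - 1),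
      if u < t ∧ t ≤ u + D then variation F u else 0 := fun t ht => by
    rw [windowVariation, ← Finset.sum_filter]
    refine Finset.sum_congr ?_ fun _ _ => rfl
    have := Finset.mem_range.1 ht
    ext u
    simp only [Finset.mem_Ico, Finset.mem_filter, Finset.mem_range]
    omega
  rw [Finset.sum_congr rfl h1, Finset.sum_comm]
  refine Finset.sum_le_sum fun u _ => ?_
  rw [← Finset.sum_filter, Finset.sum_const, nsmul_eq_mul]
  refine mul_le_mul_of_nonneg_right ?_ (variation_nonneg F u)
  -- After exchanging the sums, each one-step change is counted only by the windows of the at most D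
  -- slots that follow it.
  have : (Finset.range T).filter (fun t => u < t ∧ t ≤ u + D) ⊆ Finset.Ioc u (u + D) := by
    intro t ht
    simpa using (Finset.mem_filter.1 ht).2
  have := Finset.card_le_card this
  rw [Nat.card_Ioc] at this
  exact_mod_cast (by omega : _ ≤ D)

end Variation

/-! ### Discounted counts and the square-root potential -/

section Count

variable {K T : ℕ} (ρ : Policy K) (x : Fin T → Fin K → ℝ) {γ : ℝ} {e : ℕ}

theorem discountedCount_history (γ : ℝ) (e : ℕ) (t : ℕ) (ht : t ≤ T) (k : Fin K) :
    discountedCount γ e (ρ.history x t ht) k =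
      ∑ s : Fin t, if ρ.arm x (s.castLE ht) = k then γ ^ (t - 1 - s + e) else 0 := by
  simp only [discountedCount, ρ.history_apply]

theorem discountedCount_history_zero (γ : ℝ) (e : ℕ) (ht : 0 ≤ T) (k : Fin K) :
    discountedCount γ e (ρ.history x 0 ht) k = 0 := by
  simp [discountedCount]

theorem discountedCount_history_succ (γ : ℝ) (e : ℕ) (t : ℕ) (ht : t + 1 ≤ T) (k : Fin K) :
    discountedCount γ e (ρ.history x (t + 1) ht) k =
      γ * discountedCount γ e (ρ.history x t (Nat.le_of_succ_le ht)) k +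
        if ρ.arm x ⟨t, ht⟩ = k then γ ^ e else 0 := by
  rw [discountedCount_history, discountedCount_history, Fin.sum_univ_castSucc, Finset.mul_sum]
  congr 1
  · refine Finset.sum_congr rfl fun s _ => ?_
    rw [mul_ite, mul_zero, ← pow_succ']
    have : t + 1 - 1 - (s.castSucc : ℕ) + e = t - 1 - s + e + 1 := by
      have := s.2
      simp only [Fin.val_castSucc]
      omega
    rw [this]
    rfl
  · simp only [Fin.val_last]
    rw [show t + 1 - 1 - t + e = e by omega]
    rfl

theorem discountedCount_nonneg (hγ : 0 ≤ γ) {t : ℕ} (h : Fin t → Fin K × ℝ) (k : Fin K) :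
    0 ≤ discountedCount γ e h k :=
  Finset.sum_nonneg fun s _ => by split_ifs <;> positivity

theorem sum_discountedCount_le (hγ0 : 0 ≤ γ) (hγ1 : γ < 1) :
    ∀ (t : ℕ) (ht : t ≤ T), ∑ k, discountedCount γ e (ρ.history x t ht) k ≤ 1 / (1 - γ)
  | 0, ht => by
    simp only [discountedCount_history_zero, Finset.sum_const_zero]
    exact one_div_nonneg.2 (by linarith)
  | t + 1, ht => by
    have ih := sum_discountedCount_le hγ0 hγ1 t (Nat.le_of_succ_le ht)
    simp only [discountedCount_history_succ, Finset.sum_add_distrib, ← Finset.mul_sum,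
      Finset.sum_ite_eq, Finset.mem_univ, if_true]
    have h1 : γ ^ e ≤ 1 := pow_le_one₀ hγ0 hγ1.le
    have h2 := mul_le_mul_of_nonneg_left ih hγ0
    have h3 : γ * (1 / (1 - γ)) + 1 = 1 / (1 - γ) := by
      have : 1 - γ ≠ 0 := by linarith
      field_simp
      ring
    linarith

theorem discountedCount_le (hγ0 : 0 ≤ γ) (hγ1 : γ < 1) (t : ℕ) (ht : t ≤ T) (k : Fin K) :
    discountedCount γ e (ρ.history x t ht) k ≤ 1 / (1 - γ) :=
  (Finset.single_le_sum (f := fun k => discountedCount γ e (ρ.history x t ht) k)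
    (fun k _ => discountedCount_nonneg hγ0 _ k) (Finset.mem_univ k)).trans
    (sum_discountedCount_le ρ x hγ0 hγ1 t ht)

theorem sum_sqrt_discountedCount_le (hγ0 : 0 ≤ γ) (hγ1 : γ < 1) (t : ℕ) (ht : t ≤ T) :
    ∑ k, √(discountedCount γ e (ρ.history x t ht) k) ≤ √(K / (1 - γ)) := by
  refine Real.le_sqrt_of_sq_le ?_
  refine (sq_sum_le_card_mul_sum_sq (s := Finset.univ)).trans ?_
  rw [Finset.card_univ, Fintype.card_fin, div_eq_mul_one_div]
  refine mul_le_mul_of_nonneg_left ?_ (Nat.cast_nonneg K)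
  refine le_trans (le_of_eq ?_) (sum_discountedCount_le ρ x (e := e) hγ0 hγ1 t ht)
  exact Finset.sum_congr rfl fun k _ => Real.sq_sqrt (discountedCount_nonneg hγ0 _ k)

/-- Along every path the reciprocal square roots of the counts of the selected arms are summable
against the potential `∑ k, √(n k)`. -/
theorem sum_inv_sqrt_discountedCount_le (hγ0 : 1 / 2 ≤ γ) (hγ1 : γ < 1) (he : e ≤ 1) :
    ∀ (t : ℕ) (ht : t ≤ T), ∑ s : Fin t, 1 / √(discountedCount γ e
      (ρ.history x s (s.2.le.trans ht)) (ρ.arm x (s.castLE ht)) + 1) ≤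
        4 * (∑ k, √(discountedCount γ e (ρ.history x t ht) k) +
          t * ((1 - γ) * √(K / (1 - γ))))
  | 0, ht => by simp [discountedCount_history_zero]
  | t + 1, ht => by
    have ih := sum_inv_sqrt_discountedCount_le hγ0 hγ1 he t (Nat.le_of_succ_le ht)
    have hΦ := sum_sqrt_discountedCount_le ρ x (e := e) (by linarith) hγ1 t
      (Nat.le_of_succ_le ht)
    rw [Fin.sum_univ_castSucc]
    have e3 : (Fin.last t).castLE ht = ⟨t, ht⟩ := rfl
    simp only [Fin.castLE_castSucc, Fin.val_castSucc, Fin.val_last, e3]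
    set n : Fin K → ℝ := fun k => discountedCount γ e (ρ.history x t (Nat.le_of_succ_le ht)) k
      with hn
    have hn0 : ∀ k, 0 ≤ n k := fun k => discountedCount_nonneg (by linarith) _ k
    set j := ρ.arm x ⟨t, ht⟩ with hj
    have hsγ : γ ≤ √γ := Real.le_sqrt_of_sq_le (by nlinarith)
    have hs1 : √γ ≤ 1 := Real.sqrt_le_one.2 hγ1.le
    -- Under either weight convention a new selection adds at least γ, so the selected count becomes
    -- at least γ (n + 1).
    have hge : γ ≤ γ ^ e := by
      interval_cases e <;> simp [hγ1.le]
    have hstep : ∀ k, √γ * √(n k) + (if j = k then 1 / (4 * √(n j + 1)) else 0) ≤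
        √(discountedCount γ e (ρ.history x (t + 1) ht) k) := by
      intro k
      rw [discountedCount_history_succ, ← hj]
      split_ifs with hjk
      · subst hjk
        have hpos : 0 < √(n j + 1) := Real.sqrt_pos.2 (by linarith [hn0 j])
        have h1 : √(n j) + 1 / (2 * √(n j + 1)) ≤ √(n j + 1) := by
          have a1 := Real.sq_sqrt (hn0 j)
          have a2 := Real.sq_sqrt (show 0 ≤ n j + 1 by linarith [hn0 j])
          have a3 : 1 / (2 * √(n j + 1)) * (2 * √(n j + 1)) = 1 := by field_simp
          nlinarith [sq_nonneg (√(n j + 1) - √(n j))]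
        calc √γ * √(n j) + 1 / (4 * √(n j + 1))
            = √γ * √(n j) + 1 / 2 * (1 / (2 * √(n j + 1))) := by field_simp; ring
          _ ≤ √γ * √(n j) + √γ * (1 / (2 * √(n j + 1))) := by gcongr; linarith
          _ = √γ * (√(n j) + 1 / (2 * √(n j + 1))) := by ring
          _ ≤ √γ * √(n j + 1) := by gcongr
          _ = √(γ * (n j + 1)) := (Real.sqrt_mul (by linarith) _).symm
          _ ≤ _ := Real.sqrt_le_sqrt (by rw [mul_add, mul_one]; exact add_le_add le_rfl hge)
      · rw [add_zero, add_zero, ← Real.sqrt_mul (by linarith)]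
    -- Summed over the arms: one slot shrinks the potential at most by the factor √γ and adds at
    -- least 1 / (4 √(n + 1)) for the selected arm. The shrinkage is controlled by Cauchy–Schwarz
    -- (`hΦ`).
    have hsum := Finset.sum_le_sum fun k (_ : k ∈ Finset.univ) => hstep k
    rw [Finset.sum_add_distrib, ← Finset.mul_sum, Finset.sum_ite_eq] at hsum
    simp only [Finset.mem_univ, if_true] at hsum
    have hlast : 1 / √(n j + 1) = 4 * (1 / (4 * √(n j + 1))) := by field_simp
    have hΦ0 : 0 ≤ ∑ k, √(n k) := Finset.sum_nonneg fun k _ => Real.sqrt_nonneg _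
    have hdec : (1 - √γ) * ∑ k, √(n k) ≤ (1 - γ) * √(K / (1 - γ)) :=
      mul_le_mul (by linarith) hΦ hΦ0 (by linarith)
    change _ ≤ 4 * (∑ k, √(n k) + _) at ih
    change _ + 1 / √(n j + 1) ≤ _
    rw [hlast]
    push_cast
    linarith

end Count

/-! ### Accuracy of the discounted means and the pathwise gap bound -/

section Estimate

variable {K T : ℕ} (F : Environment K T) (ρ : Policy K) (x : Fin T → Fin K → ℝ)

/-- The discounted sum of the centered rewards received from arm `k` in the first `t` slots. -/
noncomputable def discountedNoise (γ : ℝ) (e t : ℕ) (ht : t ≤ T) (k : Fin K) : ℝ :=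
  ∑ s : Fin t, if ρ.arm x (s.castLE ht) = k then
    γ ^ (t - 1 - s + e) * (x (s.castLE ht) k - mean F (s.castLE ht) k) else 0

variable {F} {a b : ℝ} {γ : ℝ} {e : ℕ}

theorem discountedCount_sq_le (hγ0 : 0 ≤ γ) (hγ1 : γ ≤ 1) {t : ℕ} (h : Fin t → Fin K × ℝ)
    (k : Fin K) : discountedCount (γ ^ 2) e h k ≤ discountedCount γ e h k := by
  refine Finset.sum_le_sum fun s _ => ?_
  split_ifs
  · exact pow_le_pow_left₀ (sq_nonneg γ) (by nlinarith) _
  · exact le_rfl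

/-- The sum of squared nonnegative weights is at most the square of their sum. This is what tames
counts below one in the deviation bound. -/
theorem discountedCount_sq_le_sq (hγ0 : 0 ≤ γ) {t : ℕ} (h : Fin t → Fin K × ℝ)
    (k : Fin K) : discountedCount (γ ^ 2) e h k ≤ discountedCount γ e h k ^ 2 := by
  have h0 : ∀ s : Fin t, 0 ≤ if (h s).1 = k then γ ^ (t - 1 - s + e) else 0 := fun s => by
    split_ifs <;> positivity
  rw [sq (discountedCount γ e h k)]
  conv_rhs => rw [discountedCount, Finset.sum_mul]
  refine Finset.sum_le_sum fun s _ => ?_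
  have h1 := mul_le_mul_of_nonneg_left (Finset.single_le_sum (fun s _ => h0 s)
    (Finset.mem_univ s)) (h0 s)
  refine le_trans (le_of_eq ?_) h1
  split_ifs
  · rw [← mul_pow, sq]
  · simp

/-- The error is noise plus recent drift plus old bias. Since L ≥ 1, the old bias costs at most 1/8
of a radius, and 11/8 = 5/4 + 1/8. -/
theorem abs_discountedMean_sub_le (hb : 0 < b) (hF : IsSubGaussianEnv a b F) (hγ0 : 0 ≤ γ)
    (hγ1 : γ < 1) {D : ℕ} (hD : γ ^ D / (1 - γ) ≤ 1 / (64 * b ^ 2)) {L : ℝ} (hL : 1 ≤ L)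
    (t : Fin T) (k : Fin K) (hn : 0 < discountedCount γ e (ρ.history x t t.2.le) k)
    (hS : |discountedNoise F ρ x γ e t t.2.le k| ≤
      5 / 4 * √(L * discountedCount γ e (ρ.history x t t.2.le) k)) :
    |discountedMean γ e (ρ.history x t t.2.le) k - mean F t k| ≤ windowVariation F D t +
      11 / 8 * √(L / discountedCount γ e (ρ.history x t t.2.le) k) := by
  set n := discountedCount γ e (ρ.history x t t.2.le) k with hndef
  set w : Fin t → ℝ := fun s =>
    if ρ.arm x (s.castLE t.2.le) = k then γ ^ (t.1 - 1 - s + e) else 0 with hw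
  have hw0 : ∀ s, 0 ≤ w s := fun s => by
    simp only [hw]; split_ifs <;> positivity
  have hnw : n = ∑ s, w s := by rw [hndef, discountedCount_history]
  have hnum : (∑ s : Fin t, if (ρ.history x t t.2.le s).1 = k then
      γ ^ (t.1 - 1 - s + e) * (ρ.history x t t.2.le s).2 else 0) =
      discountedNoise F ρ x γ e t t.2.le k + ∑ s : Fin t, w s * mean F (s.castLE t.2.le) k := by
    rw [discountedNoise, ← Finset.sum_add_distrib]
    refine Finset.sum_congr rfl fun s _ => ?_
    simp only [ρ.history_apply, hw]
    split_ifs with h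
    · rw [h]; ring
    · simp
  have hbias := abs_sum_mul_sub_le Finset.univ w (fun s => mean F (s.castLE t.2.le) k)
    (fun s : Fin t => s.1 + D < t) (m := mean F t k) hb (windowVariation_nonneg F D t)
    (fun s _ => hw0 s)
    (fun s _ hs => abs_mean_sub_le_windowVariation F k (Fin.le_def.2 s.2.le)
      (by simpa using hs))
    (fun s _ => by
      have h1 := (hF (s.castLE t.2.le) k).2
      have h2 := (hF t k).2
      rw [abs_le]
      constructor <;> linarith [h1.1, h1.2, h2.1, h2.2])
    (by
      refine le_trans ?_ ((sum_old_weight_le hγ0 hγ1 D t).trans hD)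
      refine Finset.sum_le_sum fun s _ => ?_
      simp only [hw]
      split_ifs
      · exact pow_le_pow_of_le_one hγ0 hγ1.le (by omega)
      · positivity)
  rw [← hnw] at hbias
  have hsplit : discountedMean γ e (ρ.history x t t.2.le) k - mean F t k =
      (discountedNoise F ρ x γ e t t.2.le k +
        ∑ s, w s * (mean F (s.castLE t.2.le) k - mean F t k)) / n := by
    rw [discountedMean, hnum, ← hndef, eq_div_iff hn.ne', sub_mul, div_mul_cancel₀ _ hn.ne']
    simp only [mul_sub, Finset.sum_sub_distrib, ← Finset.sum_mul]
    rw [← hnw]; ring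
  have hsn : √n ≤ √(L * n) := Real.sqrt_le_sqrt (by nlinarith)
  have hdiv : √(L * n) = √(L / n) * n := by
    rw [Real.sqrt_mul (by linarith), Real.sqrt_div (by linarith)]
    have h1 : √n ≠ 0 := (Real.sqrt_pos.2 hn).ne'
    field_simp
    rw [Real.sq_sqrt hn.le]
  rw [hsplit, abs_div, abs_of_pos hn, div_le_iff₀ hn]
  refine (abs_add_le _ _).trans ?_
  nlinarith

theorem bestMean_sub_mean_le (hF : IsSubGaussianEnv a b F) (t : Fin T) (k : Fin K) :
    bestMean F t - mean F t k ≤ b := by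
  have : Nonempty (Fin K) := ⟨k⟩
  have h : bestMean F t ≤ a + b := ciSup_le fun j => (hF t j).2.2
  linarith [(hF t k).2.1]

/-- The initial selection of arm k still has weight at least γ ^ T. The bound is crude, but it only
has to make the grid for small counts finite. -/
theorem pow_le_discountedCount (hγ0 : 0 ≤ γ) (hγ1 : γ ≤ 1) (he : e ≤ 1)
    (hinit : ∀ t < T, ∀ h : Fin t → Fin K × ℝ, t < K → (ρ.select t h : ℕ) = t)
    (t : Fin T) (ht : K ≤ t) (k : Fin K) :
    γ ^ T ≤ discountedCount γ e (ρ.history x t t.2.le) k := by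
  rw [discountedCount_history]
  have hk : k.1 < t := k.2.trans_le ht
  have harm : ρ.arm x ((⟨k.1, hk⟩ : Fin t).castLE t.2.le) = k :=
    Fin.ext (hinit k.1 (hk.trans t.2) _ k.2)
  calc γ ^ T ≤ γ ^ (t.1 - 1 - k + e) := pow_le_pow_of_le_one hγ0 hγ1 (by omega)
    _ = if ρ.arm x ((⟨k.1, hk⟩ : Fin t).castLE t.2.le) = k then γ ^ (t.1 - 1 - k + e) else 0 := by
        rw [if_pos harm]
    _ ≤ _ := Finset.single_le_sum (f := fun s : Fin t =>
          if ρ.arm x (s.castLE t.2.le) = k then γ ^ (t.1 - 1 - s + e) else 0)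
        (fun s _ => by split_ifs <;> positivity) (Finset.mem_univ (⟨k.1, hk⟩ : Fin t))

/-- Pathwise bound of the gap of an arm of maximal index. -/
theorem gap_le_of_ucbIndex_le (hb : 0 < b) (hF : IsSubGaussianEnv a b F) (hγ0 : 0 < γ)
    (hγ1 : γ < 1) {D τ N : ℕ} (hD : γ ^ D / (1 - γ) ≤ 1 / (64 * b ^ 2)) (hτ : 4 ≤ τ)
    (hγτ : 1 / (1 - γ) ≤ τ) {ξ : ℝ} (hξ : 1 / 2 < ξ) (t : Fin T)
    (hpos : ∀ k, 0 < discountedCount γ e (ρ.history x t t.2.le) k)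
    (hN : ∀ k, 1 / discountedCount γ e (ρ.history x t t.2.le) k ≤ N)
    (hsel : ∀ k, ucbIndex γ e ξ τ (ρ.history x t t.2.le) k ≤
      ucbIndex γ e ξ τ (ρ.history x t t.2.le) (ρ.arm x t)) :
    bestMean F t - mean F t (ρ.arm x t) ≤ 2 * windowVariation F D t +
      (6 * √(ξ * Real.log τ) + 2 * b) *
        (1 / √(discountedCount γ e (ρ.history x t t.2.le) (ρ.arm x t) + 1)) +
      b * ∑ k, deviationSum τ N (discountedNoise F ρ x γ e t t.2.le k)
        (discountedCount (γ ^ 2) e (ρ.history x t t.2.le) k) := by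
  have hL : 1 ≤ Real.log τ := by
    rw [Real.le_log_iff_exp_le (by positivity)]
    have : (4 : ℝ) ≤ τ := by exact_mod_cast hτ
    linarith [Real.exp_one_lt_three]
  have hgap := bestMean_sub_mean_le hF t (ρ.arm x t)
  have hv := windowVariation_nonneg F D t
  have hdev : 0 ≤ ∑ k, deviationSum τ N (discountedNoise F ρ x γ e t t.2.le k)
      (discountedCount (γ ^ 2) e (ρ.history x t t.2.le) k) :=
    Finset.sum_nonneg fun _ _ => deviationSum_nonneg _ _ _ _
  have hdevb := mul_nonneg hb.le hdev
  have hcoef : 0 ≤ 6 * √(ξ * Real.log τ) := by positivity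
  by_cases hbad : ∃ k, 5 / 4 * √(Real.log τ * discountedCount γ e (ρ.history x t t.2.le) k) <
      |discountedNoise F ρ x γ e t t.2.le k|
  · obtain ⟨k, hk⟩ := hbad
    have h1 := one_le_deviationSum (by omega) (hpos k)
      ((discountedCount_le ρ x hγ0.le hγ1 t t.2.le k).trans hγτ) (hN k)
      (discountedCount_sq_le hγ0.le hγ1.le _ k) (discountedCount_sq_le_sq hγ0.le _ k) hk.le
    have h2 := h1.trans (Finset.single_le_sum (f := fun k => deviationSum τ N
      (discountedNoise F ρ x γ e t t.2.le k)
      (discountedCount (γ ^ 2) e (ρ.history x t t.2.le) k))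
      (fun _ _ => deviationSum_nonneg _ _ _ _) (Finset.mem_univ k))
    have h3 := mul_le_mul_of_nonneg_left h2 hb.le
    have h4 : 0 ≤ (6 * √(ξ * Real.log τ) + 2 * b) *
        (1 / √(discountedCount γ e (ρ.history x t t.2.le) (ρ.arm x t) + 1)) := by positivity
    linarith
  · push Not at hbad
    set n := discountedCount γ e (ρ.history x t t.2.le) (ρ.arm x t) with hn
    have hn0 : 0 < n := hpos _
    have hsq : 0 < √(n + 1) := Real.sqrt_pos.2 (by linarith)
    -- Below count one the gap is simply at most b, and √(n + 1) ≤ 2 lets 2 b / √(n + 1) pay for it.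
    -- Hence the shift by one under the root.
    rcases lt_or_ge n 1 with h1 | h1
    · have h2 : 1 / 2 ≤ 1 / √(n + 1) := by
        refine one_div_le_one_div_of_le hsq (Real.sqrt_le_iff.2 ⟨by norm_num, by linarith⟩)
      have h3 := mul_le_mul_of_nonneg_left h2 (show 0 ≤ 2 * b by linarith)
      have h4 := mul_nonneg hcoef (show 0 ≤ 1 / √(n + 1) by positivity)
      linarith
    · have : Nonempty (Fin K) := ⟨ρ.arm x t⟩
      obtain ⟨j, hj⟩ := exists_eq_ciSup_of_finite (f := fun k => mean F t k)
      have hbest : bestMean F t = mean F t j := hj.symm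
      have hest := fun k => abs_discountedMean_sub_le ρ x hb hF hγ0.le hγ1 hD hL t k (hpos k)
        (hbad k)
      -- This is where ξ > 1/2 enters: (11/8)² < 2 < 4 ξ.
      have hrad : ∀ m : ℝ, 0 < m →
          11 / 8 * √(Real.log τ / m) ≤ 2 * √(ξ * Real.log τ / m) := fun m hm => by
        have h2 : (11 / 8 : ℝ) = √((11 / 8) ^ 2) := (Real.sqrt_sq (by norm_num)).symm
        have h3 : (2 : ℝ) = √(2 ^ 2) := (Real.sqrt_sq (by norm_num)).symm
        rw [h2, h3, ← Real.sqrt_mul (by positivity), ← Real.sqrt_mul (by positivity)]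
        refine Real.sqrt_le_sqrt ?_
        have h4 : 0 ≤ Real.log τ / m := div_nonneg (by linarith) hm.le
        rw [mul_div_assoc]
        nlinarith
      have hlow : mean F t j - windowVariation F D t ≤
          ucbIndex γ e ξ τ (ρ.history x t t.2.le) j := by
        have h2 := (abs_le.1 (hest j)).1
        have h3 := hrad _ (hpos j)
        rw [ucbIndex]
        linarith
      have hup : ucbIndex γ e ξ τ (ρ.history x t t.2.le) (ρ.arm x t) ≤
          mean F t (ρ.arm x t) + windowVariation F D t + 4 * √(ξ * Real.log τ / n) := by
        have h2 := (abs_le.1 (hest (ρ.arm x t))).2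
        have h3 := hrad _ (hpos (ρ.arm x t))
        rw [← hn] at h2 h3
        rw [ucbIndex, ← hn]
        linarith
      have hfinal : 4 * √(ξ * Real.log τ / n) ≤
          6 * √(ξ * Real.log τ) * (1 / √(n + 1)) := by
        rw [Real.sqrt_div (by positivity)]
        have hq : 0 < √n := Real.sqrt_pos.2 hn0
        have h2 : √(n + 1) ≤ 3 / 2 * √n := by
          rw [Real.sqrt_le_left (by positivity), mul_pow, Real.sq_sqrt hn0.le]
          linarith
        have h3 : 4 * (1 / √n) ≤ 6 * (1 / √(n + 1)) := by
          rw [mul_one_div, mul_one_div, div_le_div_iff₀ hq hsq]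
          linarith
        calc 4 * (√(ξ * Real.log τ) / √n) = √(ξ * Real.log τ) * (4 * (1 / √n)) := by ring
          _ ≤ √(ξ * Real.log τ) * (6 * (1 / √(n + 1))) := by gcongr
          _ = _ := by ring
      have h5 : 0 ≤ 2 * b * (1 / √(n + 1)) := by positivity
      have h6 := hsel j
      rw [hbest]
      linarith

end Estimate

/-! ### Expected deviation weights -/

section Expectation

variable {K T : ℕ} {F : Environment K T} {a b : ℝ} (hF : IsSubGaussianEnv a b F) (ρ : Policy K)
  (γ : ℝ) (e : ℕ)
include hF

/-- For fixed t the discount weights are deterministic, so `lintegral_exp_noise_le` applies with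
these weights times θ; their squares add up to the count with discount γ². -/
theorem integrable_exp_discountedNoise (θ : ℝ) (t : ℕ) (ht : t ≤ T) (k : Fin K) :
    Integrable (fun x => Real.exp (θ * discountedNoise F ρ x γ e t ht k -
      θ ^ 2 * discountedCount (γ ^ 2) e (ρ.history x t ht) k / 8)) (rewardLaw F) ∧
    ∫ x, Real.exp (θ * discountedNoise F ρ x γ e t ht k -
      θ ^ 2 * discountedCount (γ ^ 2) e (ρ.history x t ht) k / 8) ∂(rewardLaw F) ≤ 1 := by
  set c : ℕ → ℝ := fun s => θ * γ ^ (t - 1 - s + e) with hc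
  have heq : ∀ x, θ * discountedNoise F ρ x γ e t ht k -
      θ ^ 2 * discountedCount (γ ^ 2) e (ρ.history x t ht) k / 8 = ∑ s : Fin t,
      if ρ.arm x (s.castLE ht) = k then
        c s * (x (s.castLE ht) k - mean F (s.castLE ht) k) - c s ^ 2 / 8 else 0 := fun x => by
    rw [discountedNoise, discountedCount_history, Finset.mul_sum, Finset.mul_sum,
      Finset.sum_div, ← Finset.sum_sub_distrib]
    refine Finset.sum_congr rfl fun s _ => ?_
    simp only [hc]
    split_ifs
    · rw [← pow_mul, mul_pow, ← pow_mul, mul_comm 2]; ring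
    · simp
  simp only [heq]
  have hle := lintegral_exp_noise_le hF ρ k c t ht
  have hm : Measurable fun x : Fin T → Fin K → ℝ =>
      Real.exp (∑ s : Fin t, if ρ.arm x (s.castLE ht) = k then
        c s * (x (s.castLE ht) k - mean F (s.castLE ht) k) - c s ^ 2 / 8 else 0) := by
    refine Real.measurable_exp.comp (Finset.measurable_sum _ fun s _ => ?_)
    refine Measurable.ite (ρ.measurableSet_arm_eq _ _) ?_ measurable_const
    fun_prop
  have h0 : ∀ᵐ x ∂(rewardLaw F), 0 ≤ Real.exp (∑ s : Fin t,
      if ρ.arm x (s.castLE ht) = k then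
        c s * (x (s.castLE ht) k - mean F (s.castLE ht) k) - c s ^ 2 / 8 else 0) :=
    Filter.Eventually.of_forall fun x => (Real.exp_pos _).le
  constructor
  · refine ⟨hm.aestronglyMeasurable, ?_⟩
    rw [hasFiniteIntegral_iff_ofReal h0]
    exact hle.trans_lt ENNReal.one_lt_top
  · rw [integral_eq_lintegral_of_nonneg_ae h0 hm.aestronglyMeasurable]
    exact ENNReal.toReal_le_of_le_ofReal zero_le_one (by simpa using hle)

theorem integrable_deviationWeight (θ r : ℝ) (t : ℕ) (ht : t ≤ T) (k : Fin K) :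
    Integrable (fun x => deviationWeight θ r (discountedNoise F ρ x γ e t ht k)
      (discountedCount (γ ^ 2) e (ρ.history x t ht) k)) (rewardLaw F) ∧
    ∫ x, deviationWeight θ r (discountedNoise F ρ x γ e t ht k)
      (discountedCount (γ ^ 2) e (ρ.history x t ht) k) ∂(rewardLaw F) ≤ 2 * Real.exp (-r) := by
  obtain ⟨i1, b1⟩ := integrable_exp_discountedNoise hF ρ γ e θ t ht k
  obtain ⟨i2, b2⟩ := integrable_exp_discountedNoise hF ρ γ e (-θ) t ht k
  simp only [neg_sq] at i2 b2
  unfold deviationWeight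
  refine ⟨(i1.add i2).const_mul _, ?_⟩
  rw [integral_const_mul, integral_add i1 i2]
  nlinarith [Real.exp_pos (-r)]

theorem integrable_deviationSum {τ : ℕ} (N : ℕ) (hτ : 4 ≤ τ) (t : ℕ) (ht : t ≤ T) (k : Fin K) :
    Integrable (fun x => deviationSum τ N (discountedNoise F ρ x γ e t ht k)
      (discountedCount (γ ^ 2) e (ρ.history x t ht) k)) (rewardLaw F) ∧
    ∫ x, deviationSum τ N (discountedNoise F ρ x γ e t ht k)
      (discountedCount (γ ^ 2) e (ρ.history x t ht) k) ∂(rewardLaw F) ≤ 6 / τ := by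
  have h := fun θ r => integrable_deviationWeight hF ρ γ e θ r t ht k
  unfold deviationSum
  have i1 := integrable_finsetSum (Finset.Icc 1 τ) fun m _ =>
    (h (4 * √(Real.log τ / m)) (2 * Real.log τ)).1
  have i2 := integrable_finsetSum (Finset.Icc 1 N) fun m _ =>
    (h (2 * m * √((m + 1) * Real.log τ)) ((m + 1) / 2 * Real.log τ)).1
  refine ⟨i1.add i2, ?_⟩
  rw [integral_add i1 i2, integral_finsetSum _ fun m _ => (h _ _).1,
    integral_finsetSum _ fun m _ => (h _ _).1]
  have h1 := Finset.sum_le_sum fun m (_ : m ∈ Finset.Icc 1 τ) =>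
    (h (4 * √(Real.log τ / m)) (2 * Real.log τ)).2
  have h2 := Finset.sum_le_sum fun m (_ : m ∈ Finset.Icc 1 N) =>
    (h (2 * m * √((m + 1) * Real.log τ)) ((m + 1) / 2 * Real.log τ)).2
  have h3 := sum_exp_grid_le N hτ
  rw [← Finset.mul_sum] at h1 h2
  have h4 : (6 : ℝ) / τ = 2 * (3 / τ) := by ring
  rw [h4]
  linarith

theorem regret_le_mul : regret ρ F ≤ b * T := by
  rw [regret_eq_integral hF ρ]
  have hi : Integrable (fun x => ∑ t, (bestMean F t - mean F t (ρ.arm x t))) (rewardLaw F) :=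
    integrable_finsetSum _ fun t _ => (integrable_const _).sub (integrable_mean_arm hF ρ t)
  refine (integral_mono hi (integrable_const (b * T)) fun x => ?_).trans (by simp)
  refine (Finset.sum_le_sum fun t _ => bestMean_sub_mean_le hF t (ρ.arm x t)).trans ?_
  simp [mul_comm]

end Expectation

/-! ### Summing the gaps and tuning the discount -/

section Regret

/-- The regret of an index policy that selects every arm once and then an arm of maximal
discounted upper confidence bound. -/
theorem regret_le_of_ucbIndex_le {K T : ℕ} {F : Environment K T} {a b : ℝ}
    (hb : 0 < b) (hF : IsSubGaussianEnv a b F) (ρ : Policy K) {γ : ℝ} {e : ℕ}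
    (hγ0 : 1 / 2 ≤ γ) (hγ1 : γ < 1) (he : e ≤ 1) {D τ : ℕ}
    (hD : γ ^ D / (1 - γ) ≤ 1 / (64 * b ^ 2)) (hτ : 4 ≤ τ) (hγτ : 1 / (1 - γ) ≤ τ)
    {ξ : ℝ} (hξ : 1 / 2 < ξ)
    (hsel : ∀ t < T, ∀ h : Fin t → Fin K × ℝ, (t < K → (ρ.select t h : ℕ) = t) ∧
      (K ≤ t → ∀ k, ucbIndex γ e ξ τ h k ≤ ucbIndex γ e ξ τ h (ρ.select t h))) :
    regret ρ F ≤ b * K + 2 * (D * totalVariation F) +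
      (6 * √(ξ * Real.log τ) + 2 * b) *
        (4 * (√(K / (1 - γ)) + T * ((1 - γ) * √(K / (1 - γ))))) +
      b * (T * (K * (6 / τ))) := by
  have hγpos : 0 < γ := by linarith
  -- N may be exponentially large in T; this is harmless because the expected deviation sum is
  -- bounded independently of N.
  set N := ⌈1 / γ ^ T⌉₊ with hN
  set A := 6 * √(ξ * Real.log τ) + 2 * b with hA
  have hA0 : 0 ≤ A := by positivity
  set Z : Fin T → Fin K → (Fin T → Fin K → ℝ) → ℝ := fun t k x =>
    deviationSum τ N (discountedNoise F ρ x γ e t t.2.le k)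
      (discountedCount (γ ^ 2) e (ρ.history x t t.2.le) k) with hZ
  have hZi : ∀ t k, Integrable (Z t k) (rewardLaw F) ∧ ∫ x, Z t k x ∂(rewardLaw F) ≤ 6 / τ :=
    fun t k => integrable_deviationSum hF ρ γ e N hτ t t.2.le k
  have hgap : ∀ x (t : Fin T), bestMean F t - mean F t (ρ.arm x t) ≤
      (if t.1 < K then b else 0) + 2 * windowVariation F D t +
      A * (1 / √(discountedCount γ e (ρ.history x t t.2.le) (ρ.arm x t) + 1)) +
      b * ∑ k, Z t k x := by
    intro x t
    have h2 : 0 ≤ b * ∑ k, Z t k x :=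
      mul_nonneg hb.le (Finset.sum_nonneg fun k _ => deviationSum_nonneg _ _ _ _)
    split_ifs with ht
    · have h1 := bestMean_sub_mean_le hF t (ρ.arm x t)
      have h3 := windowVariation_nonneg F D t
      have h4 : 0 ≤ A * (1 / √(discountedCount γ e (ρ.history x t t.2.le) (ρ.arm x t) + 1)) := by
        positivity
      linarith
    · rw [zero_add]
      have hpow := pow_le_discountedCount ρ x hγpos.le hγ1.le he
        (fun t ht h => (hsel t ht h).1) t (not_lt.1 ht)
      have hp : 0 < γ ^ T := by positivity
      exact gap_le_of_ucbIndex_le ρ x hb hF hγpos hγ1 hD hτ hγτ hξ t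
        (fun k => hp.trans_le (hpow k))
        (fun k => (one_div_le_one_div_of_le hp (hpow k)).trans (Nat.le_ceil _))
        ((hsel t t.2 _).2 (not_lt.1 ht))
  have hfirst : ∑ t : Fin T, (if t.1 < K then b else 0) ≤ b * K := by
    rw [Fin.sum_univ_eq_sum_range (fun t => if t < K then b else 0) T, ← Finset.sum_filter,
      Finset.sum_const, nsmul_eq_mul, mul_comm]
    refine mul_le_mul_of_nonneg_left ?_ hb.le
    have : (Finset.range T).filter (fun t => t < K) ⊆ Finset.range K := fun t ht =>
      Finset.mem_range.2 (Finset.mem_filter.1 ht).2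
    have := Finset.card_le_card this
    rw [Finset.card_range] at this
    exact_mod_cast this
  have hpath : ∀ x, ∑ t, (bestMean F t - mean F t (ρ.arm x t)) ≤
      (b * K + 2 * (D * totalVariation F) +
        A * (4 * (√(K / (1 - γ)) + T * ((1 - γ) * √(K / (1 - γ)))))) +
      b * ∑ t, ∑ k, Z t k x := by
    intro x
    refine (Finset.sum_le_sum fun t _ => hgap x t).trans ?_
    simp only [Finset.sum_add_distrib, ← Finset.mul_sum]
    have h1 := sum_windowVariation_le F D
    have h2 := sum_inv_sqrt_discountedCount_le ρ x hγ0 hγ1 he T le_rfl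
    have h3 := sum_sqrt_discountedCount_le ρ x (e := e) (by linarith) hγ1 T le_rfl
    have h4 : ∑ t : Fin T,
        1 / √(discountedCount γ e (ρ.history x t t.2.le) (ρ.arm x t) + 1) ≤
        4 * (√(K / (1 - γ)) + T * ((1 - γ) * √(K / (1 - γ)))) := by
      refine le_trans h2 ?_
      linarith
    have h5 := mul_le_mul_of_nonneg_left h4 hA0
    linarith
  rw [regret_eq_integral hF ρ]
  have hi : Integrable (fun x => ∑ t, (bestMean F t - mean F t (ρ.arm x t))) (rewardLaw F) :=
    integrable_finsetSum _ fun t _ => (integrable_const _).sub (integrable_mean_arm hF ρ t)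
  have hs : Integrable (fun x => ∑ t, ∑ k, Z t k x) (rewardLaw F) :=
    integrable_finsetSum _ fun t _ => integrable_finsetSum _ fun k _ => (hZi t k).1
  refine (integral_mono hi ((integrable_const _).add (hs.const_mul b)) hpath).trans ?_
  simp only [Pi.add_apply]
  rw [integral_add (integrable_const _) (hs.const_mul b), integral_const_mul,
    integral_finsetSum _ fun t _ => integrable_finsetSum _ fun k _ => (hZi t k).1]
  have hsum : ∑ t, ∫ x, ∑ k, Z t k x ∂(rewardLaw F) ≤ T * (K * (6 / τ)) := by
    have h1 : ∀ t, ∫ x, ∑ k, Z t k x ∂(rewardLaw F) ≤ K * (6 / τ) := fun t => by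
      rw [integral_finsetSum _ fun k _ => (hZi t k).1]
      refine (Finset.sum_le_sum fun k _ => (hZi t k).2).trans ?_
      simp
    refine (Finset.sum_le_sum fun t _ => h1 t).trans ?_
    simp
  have h6 := mul_le_mul_of_nonneg_left hsum hb.le
  simpa using h6

/-- A window length after which the discounted weights are negligible. -/
theorem exists_window_length {b d : ℝ} (hd0 : 0 < d) (hd1 : d ≤ 1) (hb : 0 < b) :
    ∃ D : ℕ, (1 - d) ^ D / d ≤ 1 / (64 * b ^ 2) ∧
      (D : ℝ) ≤ 1 / d * (Real.log (1 + 64 * b ^ 2) + Real.log (1 / d)) + 1 := by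
  -- The summand 1 keeps the logarithm nonnegative when b is small.
  have hB : 1 ≤ 1 + 64 * b ^ 2 := by nlinarith
  have hlog : 0 ≤ Real.log (1 + 64 * b ^ 2) + Real.log (1 / d) :=
    add_nonneg (Real.log_nonneg hB) (Real.log_nonneg (by rwa [le_div_iff₀ hd0, one_mul]))
  set l := Real.log (1 + 64 * b ^ 2) + Real.log (1 / d) with hl
  refine ⟨⌈1 / d * l⌉₊, ?_, (Nat.ceil_lt_add_one (by positivity)).le⟩
  set D := ⌈1 / d * l⌉₊
  have hDl : l ≤ d * D := by
    have := mul_le_mul_of_nonneg_left (Nat.le_ceil (1 / d * l)) hd0.le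
    rwa [← mul_assoc, mul_one_div_cancel hd0.ne', one_mul] at this
  have h1 : (1 - d) ^ D ≤ d / (1 + 64 * b ^ 2) := by
    calc (1 - d) ^ D ≤ Real.exp (-d) ^ D :=
          pow_le_pow_left₀ (by linarith) (Real.one_sub_le_exp_neg d) D
      _ = Real.exp (-(d * D)) := by rw [← Real.exp_nat_mul]; ring_nf
      _ ≤ Real.exp (-l) := Real.exp_le_exp.2 (by linarith)
      _ = d / (1 + 64 * b ^ 2) := by
          rw [hl, Real.exp_neg, Real.exp_add, Real.exp_log (by positivity),
            Real.exp_log (by positivity)]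
          field_simp
  calc (1 - d) ^ D / d ≤ d / (1 + 64 * b ^ 2) / d := by gcongr
    _ = 1 / (1 + 64 * b ^ 2) := by field_simp
    _ ≤ 1 / (64 * b ^ 2) := one_div_le_one_div_of_le (by positivity) (by linarith)

/-- With `d = 1 - γ`, the rate `(K V) ^ (1/3) T ^ (2/3)` equals both `V / d` and `T √(K d)`. -/
theorem rate_eq {K T V d : ℝ} (hK : 0 < K) (hT : 0 < T) (hV : 0 < V)
    (hd : d = K ^ (-(1 / 3) : ℝ) * (T / V) ^ (-(2 / 3) : ℝ)) :
    0 < d ∧ 1 / d = K ^ (1 / 3 : ℝ) * (T / V) ^ (2 / 3 : ℝ) ∧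
      (K * V) ^ (1 / 3 : ℝ) * T ^ (2 / 3 : ℝ) = V / d ∧
      (K * V) ^ (1 / 3 : ℝ) * T ^ (2 / 3 : ℝ) = T * √(K * d) := by
  have hTV : 0 < T / V := by positivity
  have hd0 : 0 < d := by rw [hd]; positivity
  have hinv : 1 / d = K ^ (1 / 3 : ℝ) * (T / V) ^ (2 / 3 : ℝ) := by
    rw [hd, Real.rpow_neg hK.le, Real.rpow_neg hTV.le]
    have h1 : K ^ (1 / 3 : ℝ) ≠ 0 := by positivity
    have h2 : (T / V) ^ (2 / 3 : ℝ) ≠ 0 := by positivity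
    field_simp
  have h13 : ∀ y : ℝ, 0 < y → (y ^ (1 / 3 : ℝ)) ^ 3 = y := fun y hy => by
    rw [← Real.rpow_natCast, ← Real.rpow_mul hy.le]; norm_num
  have h23 : ∀ y : ℝ, 0 < y → (y ^ (2 / 3 : ℝ)) ^ 3 = y ^ 2 := fun y hy => by
    rw [← Real.rpow_natCast, ← Real.rpow_mul hy.le]; norm_num
  -- The definition of d with the roots cleared; both forms of the rate follow by cubing and
  -- squaring.
  have hcube : K * T ^ 2 * d ^ 3 = V ^ 2 := by
    have h : (1 / d) ^ 3 = K * (T / V) ^ 2 := by rw [hinv, mul_pow, h13 _ hK, h23 _ hTV]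
    field_simp at h
    linarith
  have hM : (K * V) ^ (1 / 3 : ℝ) * T ^ (2 / 3 : ℝ) = V / d := by
    refine (pow_left_inj₀ (by positivity) (by positivity) (three_ne_zero)).1 ?_
    rw [mul_pow, h13 _ (by positivity), h23 _ hT, div_pow]
    field_simp
    linarith
  refine ⟨hd0, hinv, hM, hM.trans ?_⟩
  have : T * √(K * d) = √(T ^ 2 * (K * d)) := by
    rw [Real.sqrt_mul (sq_nonneg T), Real.sqrt_sq hT.le]
  rw [this, eq_comm, Real.sqrt_eq_iff_mul_self_eq (by positivity) (by positivity)]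
  field_simp
  linarith

/-- The regret bound in terms of the rate `M = V / d = T √(K d)` when `K d` is small. -/
theorem regret_bound_le_rate {K T V d b ξ τ l D W M : ℝ} (hK : 1 ≤ K) (hV : 0 < V)
    (hd0 : 0 < d) (hb : 0 < b) (hξ : 0 ≤ ξ) (hM1 : M = V / d) (hM2 : M = T * √(K * d))
    (hsmall : √(K * d) < 1 / 8) (hdτ : 1 / d ≤ τ) (hτT : τ ≤ T) (hτ : 4 ≤ τ) (hl : 0 ≤ l)
    (hD0 : 0 ≤ D) (hD : D ≤ 1 / d * (l + Real.log (1 / d)) + 1) (hW : W ≤ V) :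
    b * K + 2 * (D * W) +
      (6 * √(ξ * Real.log τ) + 2 * b) * (4 * (√(K / d) + T * (d * √(K / d)))) +
      b * (T * (K * (6 / τ))) ≤ (48 * √ξ + 2 * l + 4 + 35 * b) * Real.log T * M := by
  have hT : 0 < T := by linarith
  have hKd : 0 < K * d := by positivity
  set R := √(K * d) with hR
  have hR0 : 0 < R := Real.sqrt_pos.2 hKd
  have hR2 : R * R = K * d := Real.mul_self_sqrt hKd.le
  have hM0 : 0 < M := by rw [hM2]; positivity
  have hsqξ : 0 ≤ √ξ := Real.sqrt_nonneg ξ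
  have hd64 : d ≤ 1 / 64 := by nlinarith
  have hL1 : 1 ≤ Real.log τ := by
    rw [Real.le_log_iff_exp_le (by linarith)]
    linarith [Real.exp_one_lt_three]
  have hLT : Real.log τ ≤ Real.log T := Real.log_le_log (by linarith) hτT
  have hdT : 1 / d ≤ T := hdτ.trans hτT
  have hsq : √(K / d) = R / d := by
    rw [Real.sqrt_eq_iff_mul_self_eq (by positivity) (by positivity)]
    field_simp
    linarith
  have hdR : d * √(K / d) = R := by rw [hsq]; field_simp
  have hRT : √(K / d) ≤ M := by
    rw [hsq, hM2, div_eq_mul_one_div, mul_comm]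
    gcongr
  have hKM : K ≤ M := by
    have h1 : K = R * (R * (1 / d)) := by
      rw [← mul_assoc, hR2]; field_simp
    rw [h1, hM2]
    calc R * (R * (1 / d)) ≤ 1 * (R * T) := by gcongr; linarith
      _ = T * R := by ring
  -- Failures cost T K d up to a constant, and T K d = T R² is at most T R = M because R < 1.
  have hlast : T * (K * (6 / τ)) ≤ 6 * M := by
    have h1 : 1 / τ ≤ d := by
      rw [div_le_iff₀ (by linarith)]
      rw [div_le_iff₀ hd0] at hdτ
      linarith
    calc T * (K * (6 / τ)) = 6 * (T * (K * (1 / τ))) := by ring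
      _ ≤ 6 * (T * (K * d)) := by gcongr
      _ = 6 * (T * (R * R)) := by rw [hR2]
      _ ≤ 6 * (T * (R * 1)) := by gcongr; linarith
      _ = 6 * M := by rw [hM2]; ring
  have hlogd : Real.log (1 / d) ≤ Real.log T := Real.log_le_log (by positivity) hdT
  have hVM : V ≤ M := by
    rw [hM1, le_div_iff₀ hd0]
    exact mul_le_of_le_one_right hV.le (by linarith)
  have hvar : D * W ≤ M * (l + Real.log T) + M := by
    calc D * W ≤ D * V := by gcongr
      _ ≤ (1 / d * (l + Real.log (1 / d)) + 1) * V := by gcongr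
      _ ≤ (1 / d * (l + Real.log T) + 1) * V := by gcongr
      _ = V / d * (l + Real.log T) + V := by ring
      _ ≤ _ := by rw [← hM1]; linarith
  have hA : 6 * √(ξ * Real.log τ) + 2 * b ≤ 6 * √ξ * Real.log T + 2 * b := by
    rw [Real.sqrt_mul hξ]
    have h1 : √(Real.log τ) ≤ Real.log T := by
      refine le_trans ?_ hLT
      rw [Real.sqrt_le_left (by linarith)]
      nlinarith
    have := mul_le_mul_of_nonneg_left h1 hsqξ
    linarith
  have hpot : 4 * (√(K / d) + T * (d * √(K / d))) ≤ 8 * M := by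
    rw [hdR, ← hM2]; linarith
  have hL : 1 ≤ Real.log T := hL1.trans hLT
  generalize Real.log T = L at *
  have hprod : (6 * √(ξ * Real.log τ) + 2 * b) * (4 * (√(K / d) + T * (d * √(K / d)))) ≤
      (6 * √ξ * L + 2 * b) * (8 * M) := by
    refine mul_le_mul hA hpot (by positivity) (by positivity)
  have hbK := mul_le_mul_of_nonneg_left hKM hb.le
  have hbl := mul_le_mul_of_nonneg_left hlast hb.le
  have hML : M ≤ M * L := le_mul_of_one_le_right hM0.le hL
  have h1 := mul_le_mul_of_nonneg_left hML hb.le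
  have h2 := mul_le_mul_of_nonneg_left hML hl
  have h3 : 0 ≤ b * (M * L) := by positivity
  linarith

end Regret

end Bandit

/-! ### The two regimes of K d -/

/-- The worst-case regret of Discounted UCB over the sub-Gaussian environments with variation
budget `V` is at most `C ln T (K V) ^ (1/3) T ^ (2/3)`, where `C` depends only on the exploration
constant `ξ` and on the length `b` of the interval of means. -/
theorem theorem3 (ξ : ℝ) (hξ : 1 / 2 < ξ) (b : ℝ) (hb : 0 < b) :
    ∃ C : ℝ, 0 < C ∧
      ∀ (K T : ℕ) (V a : ℝ), 1 ≤ K → 2 ≤ T → 0 < V → Bandit.epochLength K T V ≤ T →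
        ∀ e : ℕ, e ≤ 1 → ∀ ρ : Bandit.Policy K, Bandit.IsDUCB T V ξ e ρ →
          Bandit.worstCaseRegret a b V T K ρ ≤
            ((C * Real.log T * ((K : ℝ) * V) ^ (1 / 3 : ℝ) * (T : ℝ) ^ (2 / 3 : ℝ) : ℝ) :
              EReal) := by
  set lB := Real.log (1 + 64 * b ^ 2) with hlB
  have hlB0 : 0 ≤ lB := Real.log_nonneg (by nlinarith)
  -- Here 48 = 6 · 8 comes from the radius and potential, and 2 `lB` + 4 from the drift. The main
  -- regime uses 23 b and the trivial one 16 b, so 35 b has slack.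
  refine ⟨48 * √ξ + 2 * lB + 4 + 35 * b, by positivity, ?_⟩
  intro K T V a hK hT hV hτT e he ρ hρ
  refine iSup₂_le fun F hFV => EReal.coe_le_coe_iff.2 ?_
  obtain ⟨hF, hFV⟩ := hFV
  have hK1 : (1 : ℝ) ≤ K := by exact_mod_cast hK
  have hT2 : (2 : ℝ) ≤ T := by exact_mod_cast hT
  obtain ⟨d, hd⟩ : ∃ d, d = (K : ℝ) ^ (-(1 / 3) : ℝ) * ((T : ℝ) / V) ^ (-(2 / 3) : ℝ) := ⟨_, rfl⟩
  obtain ⟨hd0, hinv, hM1, hM2⟩ := Bandit.rate_eq (by linarith) (by linarith) hV hd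
  set τ := Bandit.epochLength K T V with hτ
  -- Discounted counts never exceed 1 / d, so the grid 1, …, τ reaches all of them.
  have hdτ : 1 / d ≤ τ := by rw [hinv]; exact Nat.le_ceil _
  have hτT' : (τ : ℝ) ≤ T := by exact_mod_cast hτT
  have hγ : Bandit.discount K T V = 1 - d := by rw [Bandit.discount, hd]
  rw [mul_assoc _ (((K : ℝ) * V) ^ (1 / 3 : ℝ))]
  set M := ((K : ℝ) * V) ^ (1 / 3 : ℝ) * (T : ℝ) ^ (2 / 3 : ℝ)
  set R := √(K * d) with hR
  have hKd : 0 < K * d := by positivity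
  have hR0 : 0 < R := Real.sqrt_pos.2 hKd
  have hR2 : R * R = K * d := Real.mul_self_sqrt hKd.le
  have hM0 : 0 < M := by rw [hM2]; positivity
  have hsqξ : 0 ≤ √ξ := Real.sqrt_nonneg ξ
  -- For small R, K ≥ 1 forces d ≤ 1/64, which provides γ ≥ 1/2 and τ ≥ 4 as the analysis requires.
  rcases le_or_gt (1 / 8) R with hbig | hsmall
  · have h1 : b * T ≤ 8 * b * M := by
      rw [hM2]
      have := mul_le_mul_of_nonneg_left hbig (show 0 ≤ b * T by positivity)
      linarith
    have hlog : 1 / 2 ≤ Real.log T := by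
      have := Real.log_le_log (by norm_num) hT2
      linarith [Real.log_two_gt_d9]
    have h2 : 8 * b ≤ (48 * √ξ + 2 * lB + 4 + 35 * b) * Real.log T := by nlinarith
    calc Bandit.regret ρ F ≤ b * T := Bandit.regret_le_mul hF ρ
      _ ≤ 8 * b * M := h1
      _ ≤ _ := mul_le_mul_of_nonneg_right h2 hM0.le
  · have hd64 : d ≤ 1 / 64 := by nlinarith
    have h64 : 64 ≤ 1 / d := by rw [le_div_iff₀ hd0]; linarith
    have hτ4 : 4 ≤ τ := by
      have : 64 ≤ τ := by exact_mod_cast h64.trans hdτ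
      omega
    obtain ⟨D, hD1, hD2⟩ := Bandit.exists_window_length hd0 (by linarith) hb
    have hmain := Bandit.regret_le_of_ucbIndex_le hb hF ρ (γ := 1 - d) (e := e) (D := D)
      (τ := τ) (by linarith) (by linarith) he (by simpa using hD1) hτ4 (by simpa using hdτ) hξ
      (by rw [← hγ]; exact hρ)
    rw [sub_sub_cancel] at hmain
    exact hmain.trans (Bandit.regret_bound_le_rate hK1 hV hd0 hb (by linarith) hM1 hM2 hsmall hdτ
      hτT' (by exact_mod_cast hτ4) hlB0 (Nat.cast_nonneg D) hD2 hFV)
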